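/- Let $k_0>0$. Then there are real numbers $a<b<0$ and $A,B>0$ such that the following holds for the even, compactly supported, piecewise constant potential $q:\mathbb R\to\mathbb R$ given by $$q(x)=0\ (x<a),\qquad q(x)=A+k_0^4\ (a\le x<b),\qquad q(x)=-B+k_0^4\ (b\le x\le 0),\qquad q(x)=q(-x)\ (x>0).$$ (i) There is an even function $g\in C^3(\mathbb R;\mathbb R)$ with $g(x)=e^{k_0x}$ for all $x<a$ and $g'(0)=g'''(0)=0$ such that, at every $x\notin\{\pm a,\pm b\}$, $g'''$ is differentiable and $g''''(x)+q(x)g(x)=k_0^4\,g(x)$. This $g$ belongs to $L^2(\mathbb R)$. (ii) Let $L$ be the operator $Lu=u''''+q\,u$ in the complex Hilbert space $L^2(\mathbb R)$ whose domain consists of all $u\in L^2(\mathbb R)$ with distributional fourth derivative $u''''\in L^2(\mathbb R)$. Then $g$ is an eigenfunction of $L$ with eigenvalue $k_0^4>0$, that is, $g$ is a nonzero element of the domain of $L$ and $Lg=k_0^4g$. (iii) The continuous spectrum of $L$, i.e. the set of all $z\in\mathbb C$ for which the range of $L-z$ is not closed in $L^2(\mathbb R)$, equals $[0,\infty)$.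 In particular the eigenvalue $k_0^4$ is embedded in the continuous spectrum of $L$. -/

import Mathlib

open MeasureTheory Set
open scoped SchwartzMap LineDeriv

/-- The complex Hilbert space `L²(ℝ)`. -/
abbrev L2R : Type := Lp ℂ 2 (volume : Measure ℝ)

/-- The fourth derivative of a tempered distribution on the real line. -/
noncomputable def fourthDistDeriv (T : 𝓢'(ℝ, ℂ)) : 𝓢'(ℝ, ℂ) :=
  ∂_{(1 : ℝ)} (∂_{(1 : ℝ)} (∂_{(1 : ℝ)} (∂_{(1 : ℝ)} T)))

theorem fourthDistDeriv_add (S T : 𝓢'(ℝ, ℂ)) :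
    fourthDistDeriv (S + T) = fourthDistDeriv S + fourthDistDeriv T := by
  simp only [fourthDistDeriv, LineDeriv.lineDerivOp_add]

theorem fourthDistDeriv_smul (c : ℂ) (T : 𝓢'(ℝ, ℂ)) :
    fourthDistDeriv (c • T) = c • fourthDistDeriv T := by
  simp only [fourthDistDeriv, LineDeriv.lineDerivOp_smul]

theorem toTemperedDistribution_injective_L2R {u v : L2R}
    (h : (u : 𝓢'(ℝ, ℂ)) = (v : 𝓢'(ℝ, ℂ))) : u = v :=
  LinearMap.ker_eq_bot.1
    (Lp.ker_toTemperedDistributionCLM_eq_bot (F := ℂ) (μ := (volume : Measure ℝ)) (p := 2)) h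

theorem fourthDistDeriv_zero_L2R :
    fourthDistDeriv ((0 : L2R) : 𝓢'(ℝ, ℂ)) = ((0 : L2R) : 𝓢'(ℝ, ℂ)) := by
  have h0 : ((0 : L2R) : 𝓢'(ℝ, ℂ)) = 0 :=
    map_zero (Lp.toTemperedDistributionCLM ℂ (volume : Measure ℝ) 2)
  have h := fourthDistDeriv_add (0 : 𝓢'(ℝ, ℂ)) 0
  rw [add_zero] at h
  rw [h0]
  exact left_eq_add.1 h

/-- The graph in `L²(ℝ) × L²(ℝ)` of the operator `u ↦ u'''' + q u`: the pairs `(u, f)` such that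
the distributional derivative `u''''` is an element `w` of `L²(ℝ)` and `f = w + q u` almost
everywhere. -/
noncomputable def fourthOrderGraph (q : ℝ → ℝ) : Submodule ℂ (L2R × L2R) where
  carrier := {p | ∃ w : L2R, fourthDistDeriv (p.1 : 𝓢'(ℝ, ℂ)) = (w : 𝓢'(ℝ, ℂ)) ∧
    ∀ᵐ x : ℝ, p.2 x = w x + (q x : ℂ) * p.1 x}
  zero_mem' := by
    refine ⟨0, ?_, ?_⟩
    · exact fourthDistDeriv_zero_L2R
    · exact Filter.Eventually.of_forall fun x => by simp
  add_mem' := by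
    rintro ⟨u, f⟩ ⟨v, g⟩ ⟨w, hw, hf⟩ ⟨z, hz, hg⟩
    refine ⟨w + z, ?_, ?_⟩
    · have h1 : ((u + v : L2R) : 𝓢'(ℝ, ℂ)) = (u : 𝓢'(ℝ, ℂ)) + (v : 𝓢'(ℝ, ℂ)) :=
        map_add (Lp.toTemperedDistributionCLM ℂ (volume : Measure ℝ) 2) u v
      have h2 : ((w + z : L2R) : 𝓢'(ℝ, ℂ)) = (w : 𝓢'(ℝ, ℂ)) + (z : 𝓢'(ℝ, ℂ)) :=
        map_add (Lp.toTemperedDistributionCLM ℂ (volume : Measure ℝ) 2) w z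
      change fourthDistDeriv ((u + v : L2R) : 𝓢'(ℝ, ℂ)) = _
      rw [h1, h2, fourthDistDeriv_add]
      exact congrArg₂ (· + ·) hw hz
    · filter_upwards [hf, hg, Lp.coeFn_add u v, Lp.coeFn_add f g, Lp.coeFn_add w z]
        with x h1 h2 h3 h4 h5
      simp only [Prod.mk_add_mk, h3, h4, h5, Pi.add_apply] at *
      rw [h1, h2]; ring
  smul_mem' := by
    rintro c ⟨u, f⟩ ⟨w, hw, hf⟩
    refine ⟨c • w, ?_, ?_⟩
    · have h1 : ((c • u : L2R) : 𝓢'(ℝ, ℂ)) = c • (u : 𝓢'(ℝ, ℂ)) :=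
        map_smul (Lp.toTemperedDistributionCLM ℂ (volume : Measure ℝ) 2) c u
      have h2 : ((c • w : L2R) : 𝓢'(ℝ, ℂ)) = c • (w : 𝓢'(ℝ, ℂ)) :=
        map_smul (Lp.toTemperedDistributionCLM ℂ (volume : Measure ℝ) 2) c w
      change fourthDistDeriv ((c • u : L2R) : 𝓢'(ℝ, ℂ)) = _
      rw [h1, h2, fourthDistDeriv_smul]
      exact congrArg (c • ·) hw
    · filter_upwards [hf, Lp.coeFn_smul c u, Lp.coeFn_smul c f, Lp.coeFn_smul c w]
        with x h1 h2 h3 h4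
      simp only [Prod.smul_mk, h2, h3, h4, Pi.smul_apply, smul_eq_mul] at *
      rw [h1]; ring

/-- The graph is single valued. -/
theorem fourthOrderGraph_single_valued (q : ℝ → ℝ) (p : L2R × L2R)
    (hp : p ∈ fourthOrderGraph q) (h0 : p.1 = 0) : p.2 = 0 := by
  obtain ⟨w, hw, hf⟩ := hp
  obtain ⟨u, f⟩ := p
  simp only at h0
  subst h0
  have hw0 : w = 0 := toTemperedDistribution_injective_L2R (hw.symm.trans fourthDistDeriv_zero_L2R)
  subst hw0
  apply Lp.ext
  filter_upwards [hf, Lp.coeFn_zero ℂ 2 (volume : Measure ℝ)] with x h1 h2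
  simpa [h2] using h1

/-- The operator `L u = u'''' + q u` in `L²(ℝ)`, with domain all `u ∈ L²(ℝ)` such that `u''''` and
`q u` are in `L²(ℝ)`; for bounded measurable `q` the domain is the Sobolev space `H⁴(ℝ)`. -/
noncomputable def fourthOrderOperator (q : ℝ → ℝ) : L2R →ₗ.[ℂ] L2R :=
  (fourthOrderGraph q).toLinearPMap

theorem fourthOrderOperator_graph (q : ℝ → ℝ) :
    (fourthOrderOperator q).graph = fourthOrderGraph q :=
  Submodule.toLinearPMap_graph_eq _ (fun p hp h0 => fourthOrderGraph_single_valued q p hp h0)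

/-- `u` is an eigenvector of the (unbounded) operator `T` with eigenvalue `z`. -/
def IsEigenvectorOf {H : Type*} [AddCommGroup H] [Module ℂ H] (T : H →ₗ.[ℂ] H) (z : ℂ) (u : H) :
    Prop :=
  u ≠ 0 ∧ ∃ h : u ∈ T.domain, T ⟨u, h⟩ = z • u

/-- The continuous spectrum of an (unbounded) operator: the set of all complex `z` for which the
range of `T - z` is not closed. With this convention, usual for differential operators, an
eigenvalue may also belong to the continuous spectrum. -/
def continuousSpectrum {H : Type*} [AddCommGroup H] [Module ℂ H] [TopologicalSpace H]
    (T : H →ₗ.[ℂ] H) : Set ℂ :=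
  {z | ¬ IsClosed (range fun u : T.domain => T u - z • (u : H))}

/-- The step function equal to `A` to the left of `b` and to `-B` from `b` on. -/
noncomputable def stepQ₀ (b A B : ℝ) (x : ℝ) : ℝ :=
  if x < b then A else -B

/-- For `a < b < 0`: the even function of `x` that is `0` for `x < a` and `stepQ₀ b A B x + k₀ ^ 4`
for `a ≤ x ≤ 0`. -/
noncomputable def stepPotential (k₀ a b A B : ℝ) (x : ℝ) : ℝ :=
  if -|x| < a then 0 else stepQ₀ b A B (-|x|) + k₀ ^ 4

/-! Eigenfunction. On `x < a` take `exp (k₀ x)`; on `[a, b)` the equation reads `g'''' = -A g`, and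
around `0` it reads `g'''' = B g`. Write `A = 4α⁴`, `B = β⁴`, `r = k₀/α`, `y = β/α`, and choose the
lengths so that `α(b - a) = π` and `βb = -π`; then all sines vanish at `b` and all cosines are `-1`.
The outer data at `a` determine the middle piece, the even inner piece `c₁ cosh + c₂ cos` has two
free coefficients, and the four matching conditions at `b` reduce to two equations in `r, y`. The
first gives `y` from `r`; the intermediate value theorem gives `r` (`exists_matching_parameters`).
Reflection supplies the right half line.

Spectrum off `[0, ∞)`. There `D⁴ - z` has a bounded inverse, and the values of its solutions are
inner products with vectors `E x` of uniformly bounded norm (`exists_resolvent_kernel`). Since `q`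
is in `L²`, multiplication by `q` is compact relative to `D⁴`: weak convergence of `(D⁴ - z)uₙ`
becomes strong convergence of `q uₙ`. Hence `L - z` is bounded below on the complement of its
kernel, so its range is closed (`isClosed_range_of_notMem`).

Spectrum on `[0, ∞)`. For `c = μ⁴`, take a slowly varying packet `f(x) = exp(iμx) χ(εx)` supported
where `q = 0`. The kernel of `L - c` is not known, but `(D⁴ - c)f` is orthogonal to it by symmetry.
A closed range would give `‖(D⁴ - c)f‖ ≤ C ‖(D⁴ - c)²f‖`; each factor `D⁴ - c` contributes the same
positive power of `ε`, which contradicts this as `ε → 0` (`not_isClosed_range`). -/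

section Hilbert

/-! ### Closed range and lower bounds for closed operators -/

open Filter Topology

variable {H : Type*} [NormedAddCommGroup H] [InnerProductSpace ℂ H] [CompleteSpace H]

/-- Sequential Banach–Alaoglu in the dual of a separable space, carried back by the Riesz
isomorphism. -/
theorem exists_subseq_tendsto_inner [TopologicalSpace.SeparableSpace H] {x : ℕ → H} {C : ℝ}
    (hx : ∀ n, ‖x n‖ ≤ C) :
    ∃ (y : H) (φ : ℕ → ℕ), StrictMono φ ∧
      ∀ a : H, Tendsto (fun n => inner ℂ a (x (φ n))) atTop (𝓝 (inner ℂ a y)) := by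
  have hc := WeakDual.isSeqCompact_closedBall ℂ H (0 : StrongDual ℂ H) C
  have hmem : ∀ n, StrongDual.toWeakDual (InnerProductSpace.toDual ℂ H (x n)) ∈
      WeakDual.toStrongDual ⁻¹' Metric.closedBall (0 : StrongDual ℂ H) C := by
    intro n
    simpa using hx n
  obtain ⟨f, -, φ, hφ, hf⟩ := hc hmem
  refine ⟨(InnerProductSpace.toDual ℂ H).symm (WeakDual.toStrongDual f), φ, hφ, fun a => ?_⟩
  have h1 : Tendsto (fun n => inner ℂ (x (φ n)) a) atTop (𝓝 (f a)) :=
    ((WeakDual.eval_continuous a).tendsto f).comp hf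
  have h2 : f a = inner ℂ ((InnerProductSpace.toDual ℂ H).symm (WeakDual.toStrongDual f)) a := by
    rw [InnerProductSpace.toDual_symm_apply]; rfl
  rw [h2] at h1
  have h3 := (Complex.continuous_conj.tendsto _).comp h1
  simpa only [Function.comp_def, inner_conj_symm] using h3

/-- The vectors annihilated by the operator whose graph is `G`. -/
def graphKer (G : Submodule ℂ (H × H)) : Submodule ℂ H :=
  G.comap (LinearMap.inl ℂ H H)

omit [CompleteSpace H] in
theorem mem_graphKer {G : Submodule ℂ (H × H)} {v : H} : v ∈ graphKer G ↔ (v, (0 : H)) ∈ G :=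
  Iff.rfl

omit [CompleteSpace H] in
theorem isClosed_graphKer {G : Submodule ℂ (H × H)} (hG : IsClosed (G : Set (H × H))) :
    IsClosed (graphKer G : Set H) :=
  hG.preimage (by fun_prop : Continuous fun v : H => (v, (0 : H)))

/-- The open mapping theorem, applied to the second projection from the graph onto the closed range,
yields some preimage `r` of norm at most `C‖p.2‖`. It differs from `p` by a kernel vector, so
orthogonality gives `‖p.1‖² = ⟪r.1, p.1⟫`, and `p.1` is no longer than `r.1`. -/
theorem exists_norm_le_of_isClosed_range {G : Submodule ℂ (H × H)}
    (hG : IsClosed (G : Set (H × H))) (hR : IsClosed (Prod.snd '' (G : Set (H × H)))) :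
    ∃ C : ℝ, ∀ p ∈ G, (∀ v ∈ graphKer G, inner ℂ v p.1 = (0 : ℂ)) → ‖p.1‖ ≤ C * ‖p.2‖ := by
  let R : Submodule ℂ H := G.map (LinearMap.snd ℂ H H)
  have hRc : IsClosed (R : Set H) := by
    have : (R : Set H) = Prod.snd '' (G : Set (H × H)) := by
      ext y; simp [R]
    rwa [this]
  have : CompleteSpace G := hG.completeSpace_coe
  have : CompleteSpace R := hRc.completeSpace_coe
  let S : G →L[ℂ] R := ((ContinuousLinearMap.snd ℂ H H).comp G.subtypeL).codRestrict R
    (fun p => ⟨p, p.2, rfl⟩)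
  have hS : Function.Surjective S := by
    rintro ⟨y, p, hp, rfl⟩
    exact ⟨⟨p, hp⟩, rfl⟩
  obtain ⟨C, hC, h⟩ := S.exists_preimage_norm_le hS
  refine ⟨C, fun p hp hort => ?_⟩
  obtain ⟨r, hr, hle⟩ := h ⟨p.2, p, hp, rfl⟩
  have hr2 : (r : H × H).2 = p.2 := congrArg Subtype.val hr
  have hmem : p.1 - (r : H × H).1 ∈ graphKer G := by
    rw [mem_graphKer]
    have := G.sub_mem hp r.2
    convert this using 1
    ext <;> simp [hr2]
  have h0 := hort _ hmem
  rw [inner_sub_left, sub_eq_zero] at h0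
  have h1 : ‖p.1‖ * ‖p.1‖ ≤ ‖(r : H × H).1‖ * ‖p.1‖ := by
    have := norm_inner_le_norm (𝕜 := ℂ) (r : H × H).1 p.1
    rw [← h0, inner_self_eq_norm_sq_to_K] at this
    rw [← sq]
    simpa using this
  have h2 : ‖(r : H × H).1‖ ≤ C * ‖p.2‖ := (norm_fst_le (r : H × H)).trans hle
  rcases (norm_nonneg p.1).eq_or_lt with h3 | h3
  · rw [← h3]; positivity
  · exact (le_of_mul_le_mul_right h1 h3).trans h2

/-- Every point of the range has a preimage orthogonal to the kernel. For a convergent sequence in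
the range, the bound makes these preimages Cauchy, and the closed graph contains the limit pair. -/
theorem isClosed_range_of_norm_le {G : Submodule ℂ (H × H)}
    (hG : IsClosed (G : Set (H × H))) {C : ℝ}
    (hC : ∀ p ∈ G, (∀ v ∈ graphKer G, inner ℂ v p.1 = (0 : ℂ)) → ‖p.1‖ ≤ C * ‖p.2‖) :
    IsClosed (Prod.snd '' (G : Set (H × H))) := by
  have : CompleteSpace (graphKer G) := (isClosed_graphKer hG).completeSpace_coe
  have key : ∀ y ∈ Prod.snd '' (G : Set (H × H)), ∃ x, (x, y) ∈ G ∧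
      ∀ v ∈ graphKer G, inner ℂ v x = (0 : ℂ) := by
    rintro _ ⟨p, hp, rfl⟩
    refine ⟨p.1 - (graphKer G).starProjection p.1, ?_, fun v hv => ?_⟩
    · have h1 : ((graphKer G).starProjection p.1, (0 : H)) ∈ G :=
        mem_graphKer.1 (Submodule.starProjection_apply_mem _ _)
      have h2 := G.sub_mem hp h1
      convert h2 using 1
      ext <;> simp
    · exact (Submodule.mem_orthogonal _ _).1
        (Submodule.sub_starProjection_mem_orthogonal (K := graphKer G) p.1) v hv
  apply IsSeqClosed.isClosed
  intro y y₀ hy hlim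
  choose x hxG hxo using fun n => key (y n) (hy n)
  have hcau : CauchySeq x := by
    have hyc := hlim.cauchySeq
    rw [Metric.cauchySeq_iff] at hyc ⊢
    intro ε hε
    -- `C` has no assumed sign, so `|C| + 1` serves as a positive divisor.
    obtain ⟨N, hN⟩ := hyc (ε / (|C| + 1)) (by positivity)
    refine ⟨N, fun m hm n hn => ?_⟩
    have h1 := hC _ (G.sub_mem (hxG m) (hxG n)) (fun v hv => by
      simp [hxo m v hv, hxo n v hv])
    simp only [Prod.fst_sub, Prod.snd_sub] at h1
    have h2 := hN m hm n hn
    rw [dist_eq_norm] at h2 ⊢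
    rw [lt_div_iff₀ (by positivity)] at h2
    have h3 := norm_nonneg (y m - y n)
    nlinarith [le_abs_self C]
  obtain ⟨x₀, hx₀⟩ := cauchySeq_tendsto_of_complete hcau
  exact ⟨(x₀, y₀), hG.isSeqClosed (fun n => hxG n) (hx₀.prodMk_nhds hlim), rfl⟩

end Hilbert

/-! ### Bounded potentials and closedness of the graph -/

section Multiplication

/-- Multiplication by a bounded function on `L²(ℝ)`. -/
noncomputable def mulL2 {q : ℝ → ℝ} (hq : MemLp (fun x => (q x : ℂ)) ⊤ volume) : L2R →L[ℂ] L2R :=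
  (ContinuousLinearMap.mul ℂ ℂ).holderL volume ⊤ 2 2 (hq.toLp _)

theorem coeFn_mulL2 {q : ℝ → ℝ} (hq : MemLp (fun x => (q x : ℂ)) ⊤ volume) (u : L2R) :
    ∀ᵐ x : ℝ, mulL2 hq u x = (q x : ℂ) * u x := by
  have h := (ContinuousLinearMap.mul ℂ ℂ).coeFn_holder (r := 2) (hq.toLp _) u
  filter_upwards [h, hq.coeFn_toLp] with x h1 h2
  rw [← h2]
  exact h1

theorem mem_fourthOrderGraph_iff {q : ℝ → ℝ} (hq : MemLp (fun x => (q x : ℂ)) ⊤ volume)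
    {p : L2R × L2R} :
    p ∈ fourthOrderGraph q ↔
      fourthDistDeriv (p.1 : 𝓢'(ℝ, ℂ)) = ((p.2 - mulL2 hq p.1 : L2R) : 𝓢'(ℝ, ℂ)) := by
  constructor
  · rintro ⟨w, hw, hf⟩
    rw [hw]
    congr 1
    apply Lp.ext
    filter_upwards [hf, coeFn_mulL2 hq p.1, Lp.coeFn_sub p.2 (mulL2 hq p.1)] with x h1 h2 h3
    rw [h3, Pi.sub_apply, h2, h1]; ring
  · intro h
    refine ⟨_, h, ?_⟩
    filter_upwards [coeFn_mulL2 hq p.1, Lp.coeFn_sub p.2 (mulL2 hq p.1)] with x h2 h3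
    rw [h3, Pi.sub_apply, h2]; ring

theorem fourthDistDeriv_apply (T : 𝓢'(ℝ, ℂ)) (φ : 𝓢(ℝ, ℂ)) :
    fourthDistDeriv T φ = T (∂_{(1 : ℝ)} (∂_{(1 : ℝ)} (∂_{(1 : ℝ)} (∂_{(1 : ℝ)} φ)))) := by
  simp [fourthDistDeriv, TemperedDistribution.lineDerivOp_apply_apply, LineDeriv.lineDerivOp_neg]

/-- Moving the four derivatives onto a test function turns membership into a family of equations,
each continuous in the `L²` norm. -/
theorem isClosed_fourthOrderGraph {q : ℝ → ℝ} (hq : MemLp (fun x => (q x : ℂ)) ⊤ volume) :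
    IsClosed (fourthOrderGraph q : Set (L2R × L2R)) := by
  have : (fourthOrderGraph q : Set (L2R × L2R)) = ⋂ φ : 𝓢(ℝ, ℂ),
      {p | Lp.toTemperedDistributionCLM ℂ (volume : Measure ℝ) 2 p.1
          (∂_{(1 : ℝ)} (∂_{(1 : ℝ)} (∂_{(1 : ℝ)} (∂_{(1 : ℝ)} φ)))) =
        Lp.toTemperedDistributionCLM ℂ (volume : Measure ℝ) 2 (p.2 - mulL2 hq p.1) φ} := by
    ext p
    rw [SetLike.mem_coe, mem_fourthOrderGraph_iff hq]
    simp only [mem_iInter, mem_ofPred_eq]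
    constructor
    · intro h φ
      rw [← fourthDistDeriv_apply]
      exact congrArg (fun T : 𝓢'(ℝ, ℂ) => T φ) h
    · intro h
      ext φ
      rw [fourthDistDeriv_apply]
      exact h φ
  rw [this]
  refine isClosed_iInter fun φ => isClosed_eq ?_ ?_
  · have h := (Lp.toTemperedDistributionCLM ℂ (volume : Measure ℝ) 2).continuous
    exact (PointwiseConvergenceCLM.evalCLM (RingHom.id ℂ) ℂ
      (∂_{(1 : ℝ)} (∂_{(1 : ℝ)} (∂_{(1 : ℝ)} (∂_{(1 : ℝ)} φ))))).continuous.comp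
      (h.comp continuous_fst)
  · have h := (Lp.toTemperedDistributionCLM ℂ (volume : Measure ℝ) 2).continuous
    exact (PointwiseConvergenceCLM.evalCLM (RingHom.id ℂ) ℂ φ).continuous.comp
      (h.comp (continuous_snd.sub ((mulL2 hq).continuous.comp continuous_fst)))

end Multiplication

/-! ### Subtracting a spectral parameter -/

section Shift

variable {H : Type*} [NormedAddCommGroup H] [NormedSpace ℂ H]

/-- The graph of `T - z`, in terms of the graph of `T`. -/
noncomputable def shiftedGraph (G : Submodule ℂ (H × H)) (z : ℂ) : Submodule ℂ (H × H) :=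
  G.comap ((LinearMap.fst ℂ H H).prod (LinearMap.snd ℂ H H + z • LinearMap.fst ℂ H H))

theorem mem_shiftedGraph {G : Submodule ℂ (H × H)} {z : ℂ} {p : H × H} :
    p ∈ shiftedGraph G z ↔ (p.1, p.2 + z • p.1) ∈ G := Iff.rfl

theorem isClosed_shiftedGraph {G : Submodule ℂ (H × H)} (hG : IsClosed (G : Set (H × H))) (z : ℂ) :
    IsClosed (shiftedGraph G z : Set (H × H)) :=
  hG.preimage (by fun_prop : Continuous fun p : H × H => (p.1, p.2 + z • p.1))

theorem range_sub_smul_eq (T : H →ₗ.[ℂ] H) (z : ℂ) :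
    (range fun u : T.domain => T u - z • (u : H)) =
      Prod.snd '' (shiftedGraph T.graph z : Set (H × H)) := by
  ext y
  constructor
  · rintro ⟨u, rfl⟩
    refine ⟨((u : H), T u - z • (u : H)), ?_, rfl⟩
    rw [SetLike.mem_coe, mem_shiftedGraph]
    simp only [sub_add_cancel]
    exact T.mem_graph u
  · rintro ⟨p, hp, rfl⟩
    rw [SetLike.mem_coe, mem_shiftedGraph, LinearPMap.mem_graph_iff] at hp
    obtain ⟨u, hu1, hu2⟩ := hp
    refine ⟨u, ?_⟩
    simp only at hu1 hu2 ⊢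
    rw [hu2, hu1, add_sub_cancel_right]

theorem mem_continuousSpectrum_fourthOrderOperator {q : ℝ → ℝ} {z : ℂ} :
    z ∈ continuousSpectrum (fourthOrderOperator q) ↔
      ¬ IsClosed (Prod.snd '' (shiftedGraph (fourthOrderGraph q) z : Set (L2R × L2R))) := by
  rw [← fourthOrderOperator_graph, ← range_sub_smul_eq]
  rfl

end Shift

/-! ### Norms and dominated convergence in `L²` -/

section L2

open Filter Topology

theorem sq_norm_L2R (f : L2R) : ‖f‖ ^ 2 = ∫ x, ‖f x‖ ^ 2 := by
  have h := L2.inner_def (𝕜 := ℂ) f f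
  rw [inner_self_eq_norm_sq_to_K] at h
  have h2 : (∫ a, inner ℂ (f a) (f a)) = ((∫ x, ‖f x‖ ^ 2 : ℝ) : ℂ) := by
    rw [← integral_complex_ofReal]
    refine integral_congr_ae (Eventually.of_forall fun x => ?_)
    simp only [inner_self_eq_norm_sq_to_K]
    norm_cast
  rw [h2] at h
  apply Complex.ofReal_injective
  rw [← h]
  norm_cast

theorem tendsto_L2R_of_dominated {v : ℕ → L2R} {G : ℝ → ℂ} {b : ℝ → ℝ} (hb : MemLp b 2 volume)
    (hv : ∀ n, ∀ᵐ x, ‖v n x‖ ≤ b x) (hlim : ∀ᵐ x, Tendsto (fun n => v n x) atTop (𝓝 (G x))) :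
    ∃ y : L2R, Tendsto v atTop (𝓝 y) := by
  have hGm : AEStronglyMeasurable G volume :=
    aestronglyMeasurable_of_tendsto_ae atTop (fun n => (Lp.aestronglyMeasurable (v n))) hlim
  have hv' : ∀ᵐ x, ∀ n, ‖v n x‖ ≤ b x := ae_all_iff.2 hv
  have hGb : ∀ᵐ x, ‖G x‖ ≤ b x := by
    filter_upwards [hv', hlim] with x h1 h2
    exact le_of_tendsto h2.norm (Eventually.of_forall h1)
  have hG : MemLp G 2 volume := hb.of_le hGm (by
    filter_upwards [hGb] with x hx
    exact hx.trans (le_abs_self _))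
  refine ⟨hG.toLp G, ?_⟩
  rw [tendsto_iff_norm_sub_tendsto_zero]
  have h0 : Tendsto (fun n => ∫ x, ‖(v n - hG.toLp G) x‖ ^ 2) atTop (𝓝 (∫ _ : ℝ, (0 : ℝ))) := by
    refine tendsto_integral_of_dominated_convergence (fun x => (2 * b x) ^ 2) (fun n => ?_) ?_
      (fun n => ?_) ?_
    · exact (Lp.aestronglyMeasurable _).norm.pow 2
    · exact (hb.const_mul 2).integrable_sq
    · filter_upwards [hv n, hGb, Lp.coeFn_sub (v n) (hG.toLp G), hG.coeFn_toLp] with x h1 h2 h3 h4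
      rw [h3, Pi.sub_apply, h4, Real.norm_of_nonneg (by positivity)]
      have := norm_sub_le (v n x) (G x)
      gcongr
      linarith
    · have h3 : ∀ᵐ x, ∀ n, (v n - hG.toLp G) x = (v n - hG.toLp G : ℝ → ℂ) x :=
        ae_all_iff.2 fun n => Lp.coeFn_sub (v n) (hG.toLp G)
      filter_upwards [h3, hG.coeFn_toLp, hlim] with x h3 h4 h5
      simp only [h3, Pi.sub_apply, h4]
      have := (h5.sub_const (G x)).norm.pow 2
      simpa using this
  simp only [← sq_norm_L2R, integral_zero] at h0
  have := h0.sqrt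
  simpa using this

end L2

/-! ### The fourth derivative on the Fourier side -/

section Fourier

open FourierTransform Real TemperedDistribution

theorem fourier_fourthDistDeriv (T : 𝓢'(ℝ, ℂ)) (φ : 𝓢(ℝ, ℂ)) :
    𝓕 (fourthDistDeriv T) φ =
      (𝓕 T) (SchwartzMap.smulLeftCLM ℂ (fun ξ : ℝ => (((2 * π * ξ) ^ 4 : ℝ) : ℂ)) φ) := by
  have hg : (fun ξ : ℝ => ((inner ℝ ξ (1 : ℝ) : ℝ) : ℂ)).HasTemperateGrowth := by fun_prop
  have hg4 : (fun ξ : ℝ => (((2 * π * ξ) ^ 4 : ℝ) : ℂ)).HasTemperateGrowth := by fun_prop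
  have hφ : SchwartzMap.smulLeftCLM ℂ (fun ξ : ℝ => (((2 * π * ξ) ^ 4 : ℝ) : ℂ)) φ =
      (2 * π * Complex.I) ^ 4 •
        SchwartzMap.smulLeftCLM ℂ (fun ξ : ℝ => ((inner ℝ ξ (1 : ℝ) : ℝ) : ℂ))
          (SchwartzMap.smulLeftCLM ℂ (fun ξ : ℝ => ((inner ℝ ξ (1 : ℝ) : ℝ) : ℂ))
            (SchwartzMap.smulLeftCLM ℂ (fun ξ : ℝ => ((inner ℝ ξ (1 : ℝ) : ℝ) : ℂ))
              (SchwartzMap.smulLeftCLM ℂ (fun ξ : ℝ => ((inner ℝ ξ (1 : ℝ) : ℝ) : ℂ)) φ))) := by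
    ext ξ
    rw [SchwartzMap.smulLeftCLM_apply_apply hg4, smul_apply,
      SchwartzMap.smulLeftCLM_apply_apply hg, SchwartzMap.smulLeftCLM_apply_apply hg,
      SchwartzMap.smulLeftCLM_apply_apply hg, SchwartzMap.smulLeftCLM_apply_apply hg]
    simp only [smul_eq_mul, mul_pow, Complex.I_pow_four]
    simp
    ring
  rw [hφ, fourthDistDeriv, fourier_lineDerivOp_eq, fourier_lineDerivOp_eq, fourier_lineDerivOp_eq,
    fourier_lineDerivOp_eq]
  simp only [map_smul, smul_smul]
  have hc : (2 * π * Complex.I * (2 * π * Complex.I * (2 * π * Complex.I * (2 * π * Complex.I))) : ℂ)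
      = (2 * π * Complex.I) ^ 4 := by ring
  rw [hc]
  rfl

theorem fourier_ae_eq_of_fourthDistDeriv {u w : L2R}
    (h : fourthDistDeriv (u : 𝓢'(ℝ, ℂ)) = (w : 𝓢'(ℝ, ℂ))) :
    ∀ᵐ ξ : ℝ, (𝓕 w : L2R) ξ = (((2 * π * ξ) ^ 4 : ℝ) : ℂ) * (𝓕 u : L2R) ξ := by
  have hg4 : (fun ξ : ℝ => (((2 * π * ξ) ^ 4 : ℝ) : ℂ)).HasTemperateGrowth := by fun_prop
  have hu : LocallyIntegrable (𝓕 u : L2R) volume := (Lp.memLp _).locallyIntegrable (by norm_num)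
  refine ae_eq_of_integral_contDiff_smul_eq ((Lp.memLp _).locallyIntegrable (by norm_num)) ?_ ?_
  · exact hu.continuous_mul (by fun_prop)
  · intro g g_smooth g_cpt
    have hg₁ : HasCompactSupport (Complex.ofRealCLM ∘ g) := g_cpt.comp_left rfl
    have hg₂ : ContDiff ℝ (⊤ : ℕ∞) (Complex.ofRealCLM ∘ g) := by fun_prop
    have h1 := fourier_fourthDistDeriv (u : 𝓢'(ℝ, ℂ)) (hg₁.toSchwartzMap hg₂)
    rw [h, Lp.fourier_toTemperedDistribution_eq, Lp.fourier_toTemperedDistribution_eq,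
      Lp.toTemperedDistribution_apply, Lp.toTemperedDistribution_apply] at h1
    refine h1.trans ?_
    refine integral_congr_ae (Filter.Eventually.of_forall fun x => ?_)
    beta_reduce
    rw [SchwartzMap.smulLeftCLM_apply_apply hg4]
    simp only [HasCompactSupport.toSchwartzMap_toFun,
      Function.comp_apply, Complex.ofRealCLM_apply, smul_eq_mul, Complex.real_smul]
    ring

/-- The `L²` transform is defined abstractly, so the pointwise inversion formula is recovered by
pairing with test functions and moving the inverse transform across by Fubini. The form `-innerₗ`
carries the sign of the inverse transform. -/
theorem ae_eq_fourierInv_of_integrable {u : L2R} (hu : Integrable (𝓕 u : L2R) volume) :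
    ∀ᵐ x : ℝ, u x = ∫ ξ : ℝ, (Real.fourierChar (ξ * x) : ℂ) * (𝓕 u : L2R) ξ := by
  have heq : ∀ x : ℝ, (∫ ξ : ℝ, (Real.fourierChar (ξ * x) : ℂ) * (𝓕 u : L2R) ξ) =
      VectorFourier.fourierIntegral Real.fourierChar volume (-innerₗ ℝ) (𝓕 u : L2R) x := by
    intro x
    simp [VectorFourier.fourierIntegral, Circle.smul_def, mul_comm]
  simp only [heq]
  refine ae_eq_of_integral_contDiff_smul_eq ((Lp.memLp _).locallyIntegrable (by norm_num)) ?_ ?_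
  · refine (VectorFourier.fourierIntegral_continuous Real.continuous_fourierChar ?_
      hu).locallyIntegrable
    simp; fun_prop
  · intro g g_smooth g_cpt
    have hg₁ : HasCompactSupport (Complex.ofRealCLM ∘ g) := g_cpt.comp_left rfl
    have hg₂ : ContDiff ℝ (⊤ : ℕ∞) (Complex.ofRealCLM ∘ g) := by fun_prop
    have h1 : (u : 𝓢'(ℝ, ℂ)) (hg₁.toSchwartzMap hg₂) =
        ((𝓕 u : L2R) : 𝓢'(ℝ, ℂ)) (𝓕⁻ (hg₁.toSchwartzMap hg₂)) := by
      rw [← fourierInv_apply, Lp.fourierInv_toTemperedDistribution_eq, fourierInv_fourier_eq]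
    rw [Lp.toTemperedDistribution_apply, Lp.toTemperedDistribution_apply] at h1
    have h2 := VectorFourier.integral_fourierIntegral_smul_eq_flip (L := -innerₗ ℝ) (μ := volume)
      (ν := volume) (f := hg₁.toSchwartzMap hg₂) (g := (𝓕 u : L2R)) Real.continuous_fourierChar
      (by simp; fun_prop) (SchwartzMap.integrable _) hu
    have h3 : (-innerₗ ℝ : ℝ →ₗ[ℝ] ℝ →ₗ[ℝ] ℝ).flip = -innerₗ ℝ := by
      ext; simp
    rw [h3] at h2
    have h4 : ∀ x : ℝ, VectorFourier.fourierIntegral Real.fourierChar volume (-innerₗ ℝ)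
        (hg₁.toSchwartzMap hg₂) x = (𝓕⁻ (hg₁.toSchwartzMap hg₂)) x := by
      intro x
      rw [SchwartzMap.fourierInv_coe]
      rfl
    simp only [h4] at h2
    exact h1.trans h2

end Fourier

/-! ### Closed range away from the half line -/

section Resolvent

open FourierTransform Filter Topology

theorem exists_one_add_le_mul_norm_sub {z : ℂ} (hz : z ∉ (fun t : ℝ => (t : ℂ)) '' Ici 0) :
    ∃ K : ℝ, 0 < K ∧ ∀ t : ℝ, 0 ≤ t → 1 + t ≤ K * ‖(t : ℂ) - z‖ := by
  have hcl : IsClosed ((fun t : ℝ => (t : ℂ)) '' Ici 0) :=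
    Complex.isometry_ofReal.isClosedEmbedding.isClosedMap _ isClosed_Ici
  have hne : ((fun t : ℝ => (t : ℂ)) '' Ici 0).Nonempty := ⟨_, 0, by simp, rfl⟩
  have hd : 0 < Metric.infDist z ((fun t : ℝ => (t : ℂ)) '' Ici 0) :=
    (hcl.notMem_iff_infDist_pos hne).1 hz
  set d := Metric.infDist z ((fun t : ℝ => (t : ℂ)) '' Ici 0) with hddef
  refine ⟨(1 + ‖z‖) / d + 1, by positivity, fun t ht => ?_⟩
  have h1 : d ≤ ‖(t : ℂ) - z‖ := by
    have := Metric.infDist_le_dist_of_mem (x := z) (mem_image_of_mem (fun t : ℝ => (t : ℂ)) ht)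
    rwa [dist_comm, dist_eq_norm] at this
  have h2 : t ≤ ‖(t : ℂ) - z‖ + ‖z‖ := by
    have := norm_add_le ((t : ℂ) - z) z
    rw [sub_add_cancel, Complex.norm_of_nonneg ht] at this
    exact this
  have h3 : 1 + ‖z‖ ≤ (1 + ‖z‖) / d * ‖(t : ℂ) - z‖ := by
    rw [div_mul_eq_mul_div, le_div_iff₀ hd]
    gcongr
  linarith

/-- On the Fourier side `û = m ĥ` with `h = w - z u` and `m = ((2πξ)⁴ - z)⁻¹`. The multiplier is
bounded, which gives the norm estimate, and lies in `L²`, so `û` is integrable and inversion writes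
`u(x)` as a pairing of `h` with a vector of norm `‖m‖₂`, whatever `x` is. -/
theorem exists_resolvent_kernel {z : ℂ} (hz : z ∉ (fun t : ℝ => (t : ℂ)) '' Ici 0) :
    ∃ (E : ℝ → L2R) (M : ℝ), (∀ x, ‖E x‖ ≤ M) ∧ ∀ u w : L2R,
      fourthDistDeriv (u : 𝓢'(ℝ, ℂ)) = (w : 𝓢'(ℝ, ℂ)) →
        (∀ᵐ x : ℝ, u x = inner ℂ (E x) (w - z • u)) ∧ ‖u‖ ≤ M * ‖w - z • u‖ := by
  obtain ⟨K, hK, hKt⟩ := exists_one_add_le_mul_norm_sub hz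
  let m : ℝ → ℂ := fun ξ => ((((2 * Real.pi * ξ) ^ 4 : ℝ) : ℂ) - z)⁻¹
  have hKξ : ∀ ξ : ℝ, 1 + (2 * Real.pi * ξ) ^ 4 ≤ K * ‖(((2 * Real.pi * ξ) ^ 4 : ℝ) : ℂ) - z‖ :=
    fun ξ => hKt _ (by positivity)
  have hden : ∀ ξ : ℝ, (((2 * Real.pi * ξ) ^ 4 : ℝ) : ℂ) - z ≠ 0 := by
    intro ξ h
    have := hKξ ξ
    rw [h, norm_zero, mul_zero] at this
    have : 0 ≤ (2 * Real.pi * ξ) ^ 4 := by positivity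
    linarith
  have hmc : Continuous m := Continuous.inv₀ (by fun_prop) hden
  have hm1 : ∀ ξ, ‖m ξ‖ * (1 + (2 * Real.pi * ξ) ^ 4) ≤ K := by
    intro ξ
    rw [norm_inv, inv_mul_le_iff₀ (norm_pos_iff.2 (hden ξ))]
    exact (hKξ ξ).trans_eq (mul_comm _ _)
  have hmK : ∀ ξ, ‖m ξ‖ ≤ K := by
    intro ξ
    have h1 : 0 ≤ ‖m ξ‖ * (2 * Real.pi * ξ) ^ 4 := by positivity
    linarith [hm1 ξ]
  have hm2 : MemLp m 2 volume := by
    rw [memLp_two_iff_integrable_sq_norm hmc.aestronglyMeasurable]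
    refine (integrable_inv_one_add_sq.const_mul (2 * K ^ 2)).mono'
      (hmc.norm.pow 2).aestronglyMeasurable (Eventually.of_forall fun ξ => ?_)
    rw [Real.norm_of_nonneg (by positivity), ← div_eq_mul_inv, le_div_iff₀ (by positivity)]
    have h1 : 1 + ξ ^ 2 ≤ 2 * (1 + (2 * Real.pi * ξ) ^ 4) := by
      have h2 : ξ ^ 4 ≤ (2 * Real.pi * ξ) ^ 4 := by
        rw [mul_pow]
        exact le_mul_of_one_le_left (by positivity)
          (one_le_pow₀ (by linarith [Real.pi_gt_three]))
      nlinarith [sq_nonneg (ξ ^ 2 - 1)]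
    calc ‖m ξ‖ ^ 2 * (1 + ξ ^ 2) ≤ ‖m ξ‖ ^ 2 * (2 * (1 + (2 * Real.pi * ξ) ^ 4)) := by gcongr
      _ = 2 * (‖m ξ‖ * (‖m ξ‖ * (1 + (2 * Real.pi * ξ) ^ 4))) := by ring
      _ ≤ 2 * (K * K) := by
        have := hm1 ξ
        have := hmK ξ
        gcongr
      _ = 2 * K ^ 2 := by ring
  -- The conjugate compensates for the inner product being conjugate linear in its first argument.
  let k : ℝ → ℝ → ℂ := fun x ξ => starRingEnd ℂ ((Real.fourierChar (ξ * x) : ℂ) * m ξ)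
  have hkn : ∀ x ξ, ‖k x ξ‖ = ‖m ξ‖ := by
    intro x ξ
    simp only [k, RCLike.norm_conj, norm_mul, Circle.norm_coe, one_mul]
  have hkc : ∀ x, Continuous (k x) := by
    intro x
    have : Continuous fun ξ : ℝ => (Real.fourierChar (ξ * x) : ℂ) :=
      continuous_subtype_val.comp (Real.continuous_fourierChar.comp (by fun_prop))
    exact Complex.continuous_conj.comp (this.mul hmc)
  have hk2 : ∀ x, MemLp (k x) 2 volume := fun x =>
    hm2.of_le (hkc x).aestronglyMeasurable (Eventually.of_forall fun ξ => (hkn x ξ).le)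
  refine ⟨fun x => 𝓕⁻ ((hk2 x).toLp (k x)), ‖hm2.toLp m‖ + K, fun x => ?_, fun u w huw => ?_⟩
  · have h1 : ‖𝓕⁻ ((hk2 x).toLp (k x))‖ = ‖(hk2 x).toLp (k x)‖ := by
      rw [← Lp.norm_fourier_eq, fourier_fourierInv_eq]
    rw [h1, Lp.norm_toLp, eLpNorm_congr_norm_ae (Eventually.of_forall (hkn x)), ← Lp.norm_toLp m hm2]
    linarith
  · set h : L2R := w - z • u with hh
    have hF : (𝓕 h : L2R) = 𝓕 w - z • 𝓕 u := by
      rw [hh]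
      exact ((Lp.fourierTransformₗᵢ ℝ ℂ).map_sub w (z • u)).trans
        (congrArg (𝓕 w - ·) ((Lp.fourierTransformₗᵢ ℝ ℂ).map_smul z u))
    have hae : ∀ᵐ ξ : ℝ, (𝓕 u : L2R) ξ = m ξ * (𝓕 h : L2R) ξ := by
      filter_upwards [fourier_ae_eq_of_fourthDistDeriv huw, Lp.coeFn_sub (𝓕 w) (z • 𝓕 u : L2R),
        Lp.coeFn_smul z (𝓕 u : L2R)] with ξ h1 h2 h3
      rw [hF, h2, Pi.sub_apply, h3, h1, Pi.smul_apply, smul_eq_mul, ← sub_mul, ← mul_assoc,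
        inv_mul_cancel₀ (hden ξ), one_mul]
    constructor
    · have hint : Integrable (𝓕 u : L2R) volume :=
        (hm2.integrable_mul (Lp.memLp (𝓕 h : L2R))).congr (by
          filter_upwards [hae] with ξ hξ
          rw [hξ]; rfl)
      filter_upwards [ae_eq_fourierInv_of_integrable hint] with x hx
      rw [hx, ← Lp.inner_fourier_eq, fourier_fourierInv_eq, L2.inner_def]
      refine integral_congr_ae ?_
      filter_upwards [hae, (hk2 x).coeFn_toLp] with ξ h1 h2
      rw [h1, h2]
      simp [k]
      ring
    · have h1 : ‖(𝓕 u : L2R)‖ ≤ K * ‖(𝓕 h : L2R)‖ := by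
        refine Lp.norm_le_mul_norm_of_ae_le_mul ?_
        filter_upwards [hae] with ξ hξ
        rw [hξ, norm_mul]
        gcongr
        exact hmK ξ
      rw [Lp.norm_fourier_eq, Lp.norm_fourier_eq] at h1
      refine h1.trans ?_
      gcongr
      linarith [norm_nonneg (hm2.toLp m)]

theorem isClosed_range_of_notMem {q : ℝ → ℝ} (hq : MemLp (fun x => (q x : ℂ)) ⊤ volume)
    (hq2 : MemLp q 2 volume) {z : ℂ} (hz : z ∉ (fun t : ℝ => (t : ℂ)) '' Ici 0) :
    IsClosed (Prod.snd '' (shiftedGraph (fourthOrderGraph q) z : Set (L2R × L2R))) := by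
  obtain ⟨E, M, hE, hres⟩ := exists_resolvent_kernel hz
  set G := shiftedGraph (fourthOrderGraph q) z with hGdef
  have hGc : IsClosed (G : Set (L2R × L2R)) := isClosed_shiftedGraph (isClosed_fourthOrderGraph hq) z
  have hGmem : ∀ p ∈ G, fourthDistDeriv (p.1 : 𝓢'(ℝ, ℂ)) =
      ((p.2 + z • p.1 - mulL2 hq p.1 : L2R) : 𝓢'(ℝ, ℂ)) := fun p hp =>
    (mem_fourthOrderGraph_iff hq).1 (mem_shiftedGraph.1 hp)
  have hM : 0 ≤ M := (norm_nonneg _).trans (hE 0)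
  by_contra hcon
  have hno : ∀ n : ℕ, ∃ p ∈ G, (∀ v ∈ graphKer G, inner ℂ v p.1 = (0 : ℂ)) ∧
      (n : ℝ) * ‖p.2‖ < ‖p.1‖ := by
    intro n
    by_contra! h
    exact hcon (isClosed_range_of_norm_le hGc h)
  choose p₀ hp₀G hp₀o hp₀n using hno
  have hpos : ∀ n, 0 < ‖(p₀ n).1‖ := fun n => lt_of_le_of_lt (by positivity) (hp₀n n)
  -- Normalised, these are unit vectors orthogonal to the kernel whose images tend to zero. The
  -- index is shifted by one below because the bound with `n = 0` carries no information about
  -- `p.2`.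
  let p : ℕ → L2R × L2R := fun n => (((‖(p₀ n).1‖⁻¹ : ℝ) : ℂ)) • p₀ n
  have hpG : ∀ n, p n ∈ G := fun n => G.smul_mem _ (hp₀G n)
  have hp1 : ∀ n, ‖(p n).1‖ = 1 := by
    intro n
    simp only [p, Prod.smul_fst, norm_smul, Complex.norm_real, norm_inv, norm_norm]
    exact inv_mul_cancel₀ (hpos n).ne'
  have hpo : ∀ n, ∀ v ∈ graphKer G, inner ℂ v (p n).1 = (0 : ℂ) := by
    intro n v hv
    simp only [p, Prod.smul_fst, inner_smul_right, hp₀o n v hv, mul_zero]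
  have hp2 : ∀ n : ℕ, ‖(p (n + 1)).2‖ ≤ 1 / ((n : ℝ) + 1) := by
    intro n
    simp only [p, Prod.smul_snd, norm_smul, Complex.norm_real, norm_inv, norm_norm]
    rw [inv_mul_le_iff₀ (hpos _), mul_one_div, le_div_iff₀ (by positivity), mul_comm]
    have := (hp₀n (n + 1)).le
    push_cast at this
    exact this
  have hp2lim : Tendsto (fun n => (p (n + 1)).2) atTop (𝓝 0) :=
    squeeze_zero_norm hp2 tendsto_one_div_add_atTop_nhds_zero_nat
  -- This is `(D⁴ - z)u` for `u = (p (n + 1)).1`, to which the free resolvent applies.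
  let h : ℕ → L2R := fun n => (p (n + 1)).2 - mulL2 hq (p (n + 1)).1
  have hrep : ∀ n, (∀ᵐ x : ℝ, (p (n + 1)).1 x = inner ℂ (E x) (h n)) ∧
      ‖(p (n + 1)).1‖ ≤ M * ‖h n‖ := by
    intro n
    have := hres _ _ (hGmem _ (hpG (n + 1)))
    have heq : (p (n + 1)).2 + z • (p (n + 1)).1 - mulL2 hq (p (n + 1)).1 - z • (p (n + 1)).1 =
        h n := by simp only [h]; abel
    rwa [heq] at this
  have hhb : ∀ n, ‖h n‖ ≤ 1 + ‖mulL2 hq‖ := by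
    intro n
    refine (norm_sub_le _ _).trans (add_le_add ((hp2 n).trans ?_) ?_)
    · rw [div_le_one (by positivity)]
      linarith [(n.cast_nonneg : (0 : ℝ) ≤ n)]
    · have := (mulL2 hq).le_opNorm (p (n + 1)).1
      rwa [hp1, mul_one] at this
  have : Fact ((2 : ENNReal) ≠ ⊤) := ⟨by norm_num⟩
  obtain ⟨h₀, φ, hφ, hweak⟩ := exists_subseq_tendsto_inner hhb
  -- Relative compactness: weak convergence of `h` along `φ` gives pointwise convergence of `u(x) =
  -- ⟪E x, h⟫`, and `q u` is dominated by a multiple of `|q|`, which is in `L²`.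
  obtain ⟨y, hy⟩ := tendsto_L2R_of_dominated (v := fun n => mulL2 hq (p (φ n + 1)).1)
    (G := fun x => (q x : ℂ) * inner ℂ (E x) h₀)
    (b := fun x => M * (1 + ‖mulL2 hq‖) * ‖q x‖) (hq2.norm.const_mul _)
    (fun n => by
      filter_upwards [coeFn_mulL2 hq (p (φ n + 1)).1, (hrep (φ n)).1] with x h1 h2
      rw [h1, h2, norm_mul, mul_comm, Complex.norm_real]
      gcongr
      refine (norm_inner_le_norm _ _).trans ?_
      gcongr
      · exact hE x
      · exact hhb _)
    (by
      have h1 : ∀ᵐ x : ℝ, ∀ n, mulL2 hq (p (φ n + 1)).1 x = (q x : ℂ) * (p (φ n + 1)).1 x :=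
        ae_all_iff.2 fun n => coeFn_mulL2 hq _
      have h2 : ∀ᵐ x : ℝ, ∀ n, (p (φ n + 1)).1 x = inner ℂ (E x) (h (φ n)) :=
        ae_all_iff.2 fun n => (hrep (φ n)).1
      filter_upwards [h1, h2] with x h1 h2
      simp only [h1, h2]
      exact (hweak (E x)).const_mul _)
  have hp2φ : Tendsto (fun n => (p (φ n + 1)).2) atTop (𝓝 0) := hp2lim.comp hφ.tendsto_atTop
  have hhlim : CauchySeq (fun n => h (φ n)) := (hp2φ.sub hy).cauchySeq
  -- Now `h` converges strongly along `φ`, and the resolvent bound passes this on to the unit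
  -- vectors. Their limit will be a unit vector both in the kernel and orthogonal to it.
  have hcau : CauchySeq (fun n => (p (φ n + 1)).1) := by
    rw [Metric.cauchySeq_iff] at hhlim ⊢
    intro ε hε
    obtain ⟨N, hN⟩ := hhlim (ε / (M + 1)) (by positivity)
    refine ⟨N, fun i hi j hj => ?_⟩
    have h1 := hN i hi j hj
    have h2 := (hres _ _ (hGmem _ (G.sub_mem (hpG (φ i + 1)) (hpG (φ j + 1))))).2
    have heq : (p (φ i + 1) - p (φ j + 1)).2 + z • (p (φ i + 1) - p (φ j + 1)).1 -
        mulL2 hq (p (φ i + 1) - p (φ j + 1)).1 - z • (p (φ i + 1) - p (φ j + 1)).1 =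
        h (φ i) - h (φ j) := by
      simp only [h, Prod.fst_sub, Prod.snd_sub, map_sub]; abel
    rw [heq, Prod.fst_sub] at h2
    rw [dist_eq_norm] at h1 ⊢
    rw [lt_div_iff₀ (by positivity)] at h1
    have := norm_nonneg (h (φ i) - h (φ j))
    nlinarith
  obtain ⟨x₀, hx₀⟩ := cauchySeq_tendsto_of_complete hcau
  have hker : x₀ ∈ graphKer G := mem_graphKer.2
    (hGc.isSeqClosed (fun n => hpG (φ n + 1)) (hx₀.prodMk_nhds hp2φ))
  have hn : ‖x₀‖ = 1 := tendsto_nhds_unique hx₀.norm (by simp [hp1])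
  have ho : inner ℂ x₀ x₀ = (0 : ℂ) := by
    have h1 : Tendsto (fun n => inner ℂ x₀ (p (φ n + 1)).1) atTop (𝓝 (inner ℂ x₀ x₀)) :=
      tendsto_const_nhds.inner hx₀
    exact tendsto_nhds_unique h1 (by simp [hpo _ _ hker])
  rw [inner_self_eq_zero] at ho
  rw [ho, norm_zero] at hn
  exact zero_ne_one hn

end Resolvent

/-! ### Wave packets and the half line -/

section WavePackets

open Filter Topology

/-- The derivative of Schwartz functions on the real line. -/
noncomputable abbrev schwartzD : 𝓢(ℝ, ℂ) →L[ℂ] 𝓢(ℝ, ℂ) := SchwartzMap.derivCLM ℂ ℂ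

theorem lineDerivOp_one_eq (f : 𝓢(ℝ, ℂ)) : ∂_{(1 : ℝ)} f = schwartzD f := by
  ext x
  rw [SchwartzMap.lineDerivOp_apply_eq_fderiv, SchwartzMap.derivCLM_apply,
    fderiv_apply_one_eq_deriv]

/-- The operator `D⁴ - c` on Schwartz functions. -/
noncomputable def quarticOp (c : ℂ) : 𝓢(ℝ, ℂ) →L[ℂ] 𝓢(ℝ, ℂ) :=
  schwartzD ∘L schwartzD ∘L schwartzD ∘L schwartzD - c • ContinuousLinearMap.id ℂ _

theorem quarticOp_apply (c : ℂ) (f : 𝓢(ℝ, ℂ)) :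
    quarticOp c f = schwartzD (schwartzD (schwartzD (schwartzD f))) - c • f := rfl

theorem fourthDistDeriv_toLp (f : 𝓢(ℝ, ℂ)) :
    fourthDistDeriv ((f.toLp 2 volume : L2R) : 𝓢'(ℝ, ℂ)) =
      (((schwartzD (schwartzD (schwartzD (schwartzD f)))).toLp 2 volume : L2R) : 𝓢'(ℝ, ℂ)) := by
  simp only [fourthDistDeriv, Lp.toTemperedDistribution_toLp_eq,
    TemperedDistribution.lineDerivOp_toTemperedDistributionCLM_eq, lineDerivOp_one_eq]

theorem schwartzD_eq_zero_of_lt {f : 𝓢(ℝ, ℂ)} {R : ℝ} (hf : ∀ x < R, f x = 0) :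
    ∀ x < R, schwartzD f x = 0 := by
  intro x hx
  rw [SchwartzMap.derivCLM_apply]
  have : (f : ℝ → ℂ) =ᶠ[𝓝 x] fun _ => 0 := by
    filter_upwards [Iio_mem_nhds hx] with y hy using hf y hy
  rw [this.deriv_eq, deriv_const]

theorem quarticOp_eq_zero_of_lt {f : 𝓢(ℝ, ℂ)} {R : ℝ} (c : ℂ) (hf : ∀ x < R, f x = 0) :
    ∀ x < R, quarticOp c f x = 0 := by
  intro x hx
  have h := schwartzD_eq_zero_of_lt (schwartzD_eq_zero_of_lt
    (schwartzD_eq_zero_of_lt (schwartzD_eq_zero_of_lt hf))) x hx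
  rw [quarticOp_apply, sub_apply, smul_apply, h, hf x hx]
  simp

/-- A function with zero derivative is constant, and a Schwartz function tends to zero at infinity.
-/
theorem schwartzD_injective : Function.Injective schwartzD := by
  rw [injective_iff_map_eq_zero]
  intro f hf
  have h1 : ∀ x, deriv f x = 0 := fun x => by
    rw [← SchwartzMap.derivCLM_apply ℂ f x, hf]; rfl
  have h2 := is_const_of_deriv_eq_zero f.differentiable h1
  have h3 : Tendsto f (cocompact ℝ) (𝓝 0) := f.toZeroAtInfty.zero_at_infty'
  ext x
  have h4 : (f : ℝ → ℂ) = fun _ => f x := funext fun y => h2 y x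
  rw [h4] at h3
  exact tendsto_nhds_unique tendsto_const_nhds h3

/-- Complex conjugation of Schwartz functions. -/
noncomputable def schwartzConj (f : 𝓢(ℝ, ℂ)) : 𝓢(ℝ, ℂ) :=
  f.postcompCLM (Complex.conjCLE : ℂ →L[ℝ] ℂ)

theorem schwartzConj_apply (f : 𝓢(ℝ, ℂ)) (x : ℝ) : schwartzConj f x = starRingEnd ℂ (f x) := rfl

theorem schwartzD_schwartzConj (f : 𝓢(ℝ, ℂ)) :
    schwartzD (schwartzConj f) = schwartzConj (schwartzD f) := by
  ext x
  rw [SchwartzMap.derivCLM_apply, schwartzConj_apply, SchwartzMap.derivCLM_apply]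
  exact ((Complex.conjCLE : ℂ →L[ℝ] ℂ).hasFDerivAt.comp_hasDerivAt x (f.hasDerivAt x)).deriv

theorem toLp_mem_shiftedGraph {q : ℝ → ℝ} {R : ℝ} (hqR : ∀ x, R ≤ x → q x = 0) (c : ℂ)
    {f : 𝓢(ℝ, ℂ)} (hf : ∀ x < R, f x = 0) :
    ((f.toLp 2 volume : L2R), ((quarticOp c f).toLp 2 volume : L2R)) ∈
      shiftedGraph (fourthOrderGraph q) c := by
  rw [mem_shiftedGraph]
  refine ⟨_, fourthDistDeriv_toLp f, ?_⟩
  filter_upwards [Lp.coeFn_add ((quarticOp c f).toLp 2 volume : L2R) (c • f.toLp 2 volume),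
    Lp.coeFn_smul c (f.toLp 2 volume), f.coeFn_toLp 2 volume, (quarticOp c f).coeFn_toLp 2 volume,
    (schwartzD (schwartzD (schwartzD (schwartzD f)))).coeFn_toLp 2 volume] with x h1 h2 h3 h4 h5
  change ((quarticOp c f).toLp 2 volume + c • f.toLp 2 volume : L2R) x =
    _ + (q x : ℂ) * (f.toLp 2 volume : L2R) x
  rw [h1, Pi.add_apply, h2, Pi.smul_apply, h3, h4, h5, quarticOp_apply, sub_apply, smul_apply,
    sub_add_cancel]
  rcases lt_or_ge x R with hx | hx
  · simp [hf x hx]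
  · simp [hqR x hx]

/-- Symmetry of `L` with `c` real: for `v` in the kernel, `⟪v, (L - c)f⟫ = ⟪(L - c)v, f⟫ = 0`, and
`L f = D⁴ f` because `f` and `q` have no common support. -/
theorem inner_ker_quarticOp_eq_zero {q : ℝ → ℝ} (hq : MemLp (fun x => (q x : ℂ)) ⊤ volume) {R : ℝ}
    (hqR : ∀ x, R ≤ x → q x = 0) (c : ℝ) {f : 𝓢(ℝ, ℂ)} (hf : ∀ x < R, f x = 0) {v : L2R}
    (hv : v ∈ graphKer (shiftedGraph (fourthOrderGraph q) (c : ℂ))) :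
    inner ℂ v ((quarticOp c f).toLp 2 volume : L2R) = (0 : ℂ) := by
  have h1 := (mem_fourthOrderGraph_iff hq).1 (mem_shiftedGraph.1 (mem_graphKer.1 hv))
  -- The distributional pairing is bilinear, hence the conjugate of `f` as test function.
  have h2 := congrArg (fun T : 𝓢'(ℝ, ℂ) => T (schwartzConj f)) h1
  simp only [fourthDistDeriv_apply, lineDerivOp_one_eq, schwartzD_schwartzConj, zero_add,
    Lp.toTemperedDistribution_apply] at h2
  rw [← inner_conj_symm, L2.inner_def, map_eq_zero]
  have hi : ∀ (g : 𝓢(ℝ, ℂ)) (u : L2R), Integrable (fun x => g x • u x) volume := fun g u =>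
    (g.memLp 2 volume).integrable_mul (Lp.memLp u)
  have h3 : (∫ x, inner ℂ ((quarticOp c f).toLp 2 volume x) (v x)) =
      (∫ x, schwartzConj (schwartzD (schwartzD (schwartzD (schwartzD f)))) x • v x) -
        ∫ x, schwartzConj f x • ((c : ℂ) • v - mulL2 hq v : L2R) x := by
    rw [← integral_sub (hi _ _) (hi _ _)]
    refine integral_congr_ae ?_
    filter_upwards [(quarticOp c f).coeFn_toLp 2 volume, Lp.coeFn_sub ((c : ℂ) • v) (mulL2 hq v),
      Lp.coeFn_smul (c : ℂ) v, coeFn_mulL2 hq v] with x h1 h2 h3 h4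
    rw [h1, h2, Pi.sub_apply, h3, h4]
    simp only [quarticOp_apply, sub_apply, smul_apply, Pi.smul_apply, schwartzConj_apply,
      smul_eq_mul, RCLike.inner_apply, map_sub, map_mul, Complex.conj_ofReal]
    rcases lt_or_ge x R with hx | hx
    · simp [hf x hx]; ring
    · simp [hqR x hx]; ring
  rw [h3, h2, sub_self]

/-- `f` is the function `χ` dilated by `ε` and modulated with frequency `μ`. -/
def IsPacket (ε μ : ℝ) (f χ : 𝓢(ℝ, ℂ)) : Prop :=
  ∀ x : ℝ, f x = Complex.exp (Complex.I * μ * x) * χ (ε * x)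

/-- The operator on profiles that corresponds to the derivative of packets. -/
noncomputable def packetD (ε μ : ℝ) : 𝓢(ℝ, ℂ) →L[ℂ] 𝓢(ℝ, ℂ) :=
  (Complex.I * μ) • ContinuousLinearMap.id ℂ _ + (ε : ℂ) • schwartzD

theorem packetD_apply (ε μ : ℝ) (χ : 𝓢(ℝ, ℂ)) :
    packetD ε μ χ = (Complex.I * μ) • χ + (ε : ℂ) • schwartzD χ := rfl

/-- The operator on profiles that corresponds to `D⁴ - μ⁴` on packets. -/
noncomputable def packetQuarticOp (ε μ : ℝ) : 𝓢(ℝ, ℂ) →L[ℂ] 𝓢(ℝ, ℂ) :=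
  packetD ε μ ∘L packetD ε μ ∘L packetD ε μ ∘L packetD ε μ -
    ((μ ^ 4 : ℝ) : ℂ) • ContinuousLinearMap.id ℂ _

theorem IsPacket.schwartzD {ε μ : ℝ} {f χ : 𝓢(ℝ, ℂ)} (h : IsPacket ε μ f χ) :
    IsPacket ε μ (schwartzD f) (packetD ε μ χ) := by
  intro x
  have hf : (f : ℝ → ℂ) = fun x : ℝ => Complex.exp (Complex.I * μ * x) * χ (ε * x) := funext h
  have h1 : HasDerivAt (fun x : ℝ => Complex.exp (Complex.I * μ * x))
      (Complex.exp (Complex.I * μ * x) * (Complex.I * μ * 1)) x :=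
    (((hasDerivAt_id x).ofReal_comp.const_mul (Complex.I * (μ : ℂ)))).cexp
  have h2 : HasDerivAt (fun x : ℝ => χ (ε * x)) ((ε * 1) • deriv χ (ε * x)) x :=
    (χ.hasDerivAt (ε * x)).scomp x ((hasDerivAt_id x).const_mul ε)
  rw [SchwartzMap.derivCLM_apply, hf, (h1.fun_mul h2).deriv]
  simp only [packetD_apply, add_apply, smul_apply, SchwartzMap.derivCLM_apply, smul_eq_mul,
    Complex.real_smul]
  push_cast
  ring

theorem IsPacket.quarticOp {ε μ : ℝ} {f χ : 𝓢(ℝ, ℂ)} (h : IsPacket ε μ f χ) :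
    IsPacket ε μ (quarticOp ((μ ^ 4 : ℝ) : ℂ) f) (packetQuarticOp ε μ χ) := by
  intro x
  have h4 := h.schwartzD.schwartzD.schwartzD.schwartzD x
  rw [quarticOp_apply, sub_apply, smul_apply, h4, h x]
  simp only [packetQuarticOp, sub_apply, smul_apply, ContinuousLinearMap.comp_apply,
    ContinuousLinearMap.id_apply, smul_eq_mul]
  ring

theorem IsPacket.sq_norm_toLp {ε μ : ℝ} (hε : 0 < ε) {f χ : 𝓢(ℝ, ℂ)} (h : IsPacket ε μ f χ) :
    ‖(f.toLp 2 volume : L2R)‖ ^ 2 = ε⁻¹ * ‖(χ.toLp 2 volume : L2R)‖ ^ 2 := by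
  have hn : ∀ g : 𝓢(ℝ, ℂ), ‖(g.toLp 2 volume : L2R)‖ ^ 2 = ∫ x, ‖g x‖ ^ 2 := by
    intro g
    rw [sq_norm_L2R]
    refine integral_congr_ae ?_
    filter_upwards [g.coeFn_toLp 2 volume] with x hx
    rw [hx]
  rw [hn, hn]
  have h1 : ∀ x, ‖f x‖ ^ 2 = (fun y => ‖χ y‖ ^ 2) (ε * x) := by
    intro x
    have : Complex.I * μ * x = ((μ * x : ℝ) : ℂ) * Complex.I := by push_cast; ring
    rw [h x, norm_mul, this, Complex.norm_exp_ofReal_mul_I, one_mul]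
  simp_rw [h1]
  rw [Measure.integral_comp_mul_left (fun y => ‖χ y‖ ^ 2) ε, abs_of_pos (by positivity),
    smul_eq_mul]

/-- In the expansion of `(iμ + εD)⁴ - μ⁴` the constant term cancels as `i⁴ = 1`. The lowest
remaining term is `4ε(iμ)³D` if `μ ≠ 0` and `ε⁴D⁴` if `μ = 0`; either is injective on Schwartz
functions. -/
theorem exists_packetQuarticOp_eq (μ : ℝ) :
    ∃ (m : ℕ) (Q : ℝ → 𝓢(ℝ, ℂ) → 𝓢(ℝ, ℂ)), m ≠ 0 ∧
      (∀ ε χ, packetQuarticOp ε μ χ = ((ε : ℂ) ^ m) • Q ε χ) ∧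
      (∀ g : ℝ → 𝓢(ℝ, ℂ), Continuous g → Continuous fun ε => Q ε (g ε)) ∧
      ∀ χ, χ ≠ 0 → Q 0 χ ≠ 0 := by
  have hinj : ∀ {χ}, χ ≠ 0 → schwartzD χ ≠ 0 := fun h h0 =>
    h (schwartzD_injective (h0.trans (map_zero _).symm))
  rcases eq_or_ne μ 0 with rfl | hμ
  · refine ⟨4, fun _ χ => schwartzD (schwartzD (schwartzD (schwartzD χ))), by norm_num,
      fun ε χ => ?_, fun g hg => by fun_prop, fun χ h => hinj (hinj (hinj (hinj h)))⟩
    ext x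
    simp only [packetQuarticOp, packetD_apply, smul_apply, map_smul,
      ContinuousLinearMap.comp_apply, smul_eq_mul,
      Complex.ofReal_zero, mul_zero, zero_smul, zero_add, ne_eq, OfNat.ofNat_ne_zero,
      not_false_eq_true, zero_pow, sub_zero]
    ring
  · refine ⟨1, fun ε χ => (4 * (Complex.I * μ) ^ 3) • schwartzD χ +
      (ε : ℂ) • (6 * (Complex.I * μ) ^ 2) • schwartzD (schwartzD χ) +
      ((ε : ℂ) ^ 2) • (4 * (Complex.I * μ)) • schwartzD (schwartzD (schwartzD χ)) +
      ((ε : ℂ) ^ 3) • schwartzD (schwartzD (schwartzD (schwartzD χ))), by norm_num,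
      fun ε χ => ?_, fun g hg => by fun_prop, fun χ h => ?_⟩
    · ext x
      have hI : (Complex.I * μ : ℂ) ^ 4 = (μ : ℂ) ^ 4 := by
        rw [mul_pow, Complex.I_pow_four, one_mul]
      simp only [packetQuarticOp, packetD_apply, sub_apply, smul_apply, add_apply, map_add,
        map_smul, ContinuousLinearMap.comp_apply, ContinuousLinearMap.id_apply, smul_eq_mul,
        Complex.ofReal_pow]
      rw [← hI]
      ring
    · simp only [Complex.ofReal_zero, zero_smul, add_zero, ne_eq, not_false_eq_true, zero_pow,
        OfNat.ofNat_ne_zero]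
      refine smul_ne_zero ?_ (hinj h)
      have : (μ : ℂ) ≠ 0 := by exact_mod_cast hμ
      simp [this]

theorem exists_packet_profile : ∃ χ : 𝓢(ℝ, ℂ), χ ≠ 0 ∧ (∀ x < 1, χ x = 0) ∧
    ∀ ε μ : ℝ, 0 < ε → ∃ f : 𝓢(ℝ, ℂ), IsPacket ε μ f χ := by
  let φ : ContDiffBump (2 : ℝ) := ⟨1 / 2, 1, by norm_num, by norm_num⟩
  have h1 : HasCompactSupport (fun x => (φ x : ℂ)) :=
    φ.hasCompactSupport.comp_left (g := fun t : ℝ => (t : ℂ)) Complex.ofReal_zero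
  have h2 : ContDiff ℝ (⊤ : ℕ∞) (fun x => (φ x : ℂ)) :=
    Complex.ofRealCLM.contDiff.comp φ.contDiff
  refine ⟨h1.toSchwartzMap h2, fun h => ?_, fun x hx => ?_, fun ε μ hε => ?_⟩
  · have h3 := congrArg (fun f : 𝓢(ℝ, ℂ) => f 2) h
    have h4 : φ 2 = 1 := φ.one_of_mem_closedBall (Metric.mem_closedBall_self φ.rIn_pos.le)
    simp [h4] at h3
  · have : φ x = 0 := φ.zero_of_le_dist (by
      rw [Real.dist_eq, abs_of_neg (by linarith)]
      change (1 : ℝ) ≤ _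
      linarith)
    simp [this]
  · have h3 : HasCompactSupport (fun x : ℝ => Complex.exp (Complex.I * μ * x) * (φ (ε * x) : ℂ)) :=
      (h1.comp_homeomorph (Homeomorph.mulLeft₀ ε hε.ne')).mul_left
    have h4 : ContDiff ℝ (⊤ : ℕ∞)
        (fun x : ℝ => Complex.exp (Complex.I * μ * x) * (φ (ε * x) : ℂ)) := by
      refine ContDiff.mul ?_ (h2.comp (contDiff_const.mul contDiff_id))
      exact (contDiff_const.mul Complex.ofRealCLM.contDiff).cexp
    exact ⟨h3.toSchwartzMap h4, fun x => rfl⟩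

theorem not_isClosed_range {q : ℝ → ℝ} (hq : MemLp (fun x => (q x : ℂ)) ⊤ volume) {R : ℝ}
    (hqR : ∀ x, R ≤ x → q x = 0) (μ : ℝ) :
    ¬ IsClosed (Prod.snd ''
      (shiftedGraph (fourthOrderGraph q) ((μ ^ 4 : ℝ) : ℂ) : Set (L2R × L2R))) := by
  intro hcl
  obtain ⟨C, hC⟩ := exists_norm_le_of_isClosed_range
    (isClosed_shiftedGraph (isClosed_fourthOrderGraph hq) _) hcl
  obtain ⟨χ, hχ0, hχ1, hpk⟩ := exists_packet_profile
  obtain ⟨m, Q, hm, hPQ, hQc, hQ0⟩ := exists_packetQuarticOp_eq μ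
  let N : 𝓢(ℝ, ℂ) → ℝ := fun f => ‖(f.toLp 2 volume : L2R)‖
  have hNc : Continuous N := (SchwartzMap.toLpCLM ℂ ℂ 2 (volume : Measure ℝ)).continuous.norm
  have hNs : ∀ (a : ℂ) f, N (a • f) = ‖a‖ * N f := fun a f => by
    change ‖SchwartzMap.toLpCLM ℂ ℂ 2 (volume : Measure ℝ) (a • f)‖ = _
    rw [map_smul, norm_smul]
    rfl
  have key : ∀ᶠ ε : ℝ in 𝓝[>] 0, N (Q ε χ) ≤ |C| * (ε ^ m * N (Q ε (Q ε χ))) := by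
    -- The profile vanishes to the left of `1`, so the packet vanishes on `x < R` once `εR < 1`.
    have hsmall : ∀ᶠ ε : ℝ in 𝓝[>] 0, ε * R < 1 := by
      have : Tendsto (fun ε : ℝ => ε * R) (𝓝[>] 0) (𝓝 (0 * R)) :=
        (tendsto_id.mul_const R).mono_left nhdsWithin_le_nhds
      rw [zero_mul] at this
      exact this.eventually (Iio_mem_nhds one_pos)
    filter_upwards [hsmall, self_mem_nhdsWithin] with ε hεR hε
    have hε : 0 < ε := hε
    obtain ⟨f, hf⟩ := hpk ε μ hε
    have hfR : ∀ x < R, f x = 0 := by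
      intro x hx
      rw [hf x, hχ1 _ (by nlinarith), mul_zero]
    have h1 := hC _ (toLp_mem_shiftedGraph hqR ((μ ^ 4 : ℝ) : ℂ)
      (quarticOp_eq_zero_of_lt ((μ ^ 4 : ℝ) : ℂ) hfR))
      (fun v hv => inner_ker_quarticOp_eq_zero hq hqR (μ ^ 4) hfR hv)
    simp only at h1
    -- Both packets have the same dilation factor `ε⁻¹` in their squared norms, so the estimate
    -- descends to the profiles.
    have h2 : N (packetQuarticOp ε μ χ) ≤
        |C| * N (packetQuarticOp ε μ (packetQuarticOp ε μ χ)) := by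
      have h3 := hf.quarticOp.sq_norm_toLp hε
      have h4 := hf.quarticOp.quarticOp.sq_norm_toLp hε
      have h5 := h1.trans (mul_le_mul_of_nonneg_right (le_abs_self C) (norm_nonneg _))
      have h6 := pow_le_pow_left₀ (norm_nonneg _) h5 2
      rw [mul_pow, h3, h4, mul_left_comm, ← mul_pow] at h6
      exact (sq_le_sq₀ (by positivity) (by positivity)).1
        (le_of_mul_le_mul_left h6 (by positivity))
    rw [hPQ ε χ, map_smul, hPQ ε (Q ε χ), hNs, hNs, hNs, mul_left_comm] at h2
    have h3 : ‖(ε : ℂ) ^ m‖ = ε ^ m := by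
      rw [norm_pow, Complex.norm_of_nonneg hε.le]
    rw [h3] at h2
    exact le_of_mul_le_mul_left h2 (by positivity)
  have hl : Tendsto (fun ε => N (Q ε χ)) (𝓝[>] 0) (𝓝 (N (Q 0 χ))) :=
    ((hNc.comp (hQc _ continuous_const)).tendsto 0).mono_left nhdsWithin_le_nhds
  have hr : Tendsto (fun ε => |C| * (ε ^ m * N (Q ε (Q ε χ)))) (𝓝[>] 0)
      (𝓝 (|C| * (0 ^ m * N (Q 0 (Q 0 χ))))) := by
    have : Continuous fun ε => |C| * (ε ^ m * N (Q ε (Q ε χ))) :=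
      continuous_const.mul ((continuous_id.pow m).mul
        (hNc.comp (hQc _ (hQc _ continuous_const))))
    exact (this.tendsto 0).mono_left nhdsWithin_le_nhds
  have hle := le_of_tendsto_of_tendsto hl hr key
  rw [zero_pow hm, zero_mul, mul_zero] at hle
  have h0 : (Q 0 χ).toLp 2 volume = 0 := norm_eq_zero.1 (le_antisymm hle (norm_nonneg _))
  refine hQ0 χ hχ0 (SchwartzMap.injective_toLp 2 volume ?_)
  exact h0.trans (map_zero (SchwartzMap.toLpCLM ℂ ℂ 2 (volume : Measure ℝ))).symm

theorem continuousSpectrum_fourthOrderOperator {q : ℝ → ℝ}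
    (hq : MemLp (fun x => (q x : ℂ)) ⊤ volume) (hq2 : MemLp q 2 volume) {R : ℝ}
    (hqR : ∀ x, R ≤ x → q x = 0) :
    continuousSpectrum (fourthOrderOperator q) = (fun t : ℝ => (t : ℂ)) '' Ici 0 := by
  ext z
  rw [mem_continuousSpectrum_fourthOrderOperator]
  constructor
  · intro h
    by_contra hz
    exact h (isClosed_range_of_notMem hq hq2 hz)
  · rintro ⟨t, ht, rfl⟩
    have h := not_isClosed_range hq hqR (√√t)
    have h4 : √√t ^ 4 = t := by
      rw [show 4 = 2 * 2 by norm_num, pow_mul, Real.sq_sqrt (Real.sqrt_nonneg _),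
        Real.sq_sqrt ht]
    rwa [h4] at h

end WavePackets

/-! ### Piecewise smooth functions and their distributional derivatives -/

section Jets

open Filter Topology

/-- Equality of the derivatives is required only at `x = c`: away from the junction the same lemma
then differentiates the third derivative, whose own derivative may jump at `c`. -/
theorem hasDerivAt_ite_lt {f g f' g' : ℝ → ℝ} {c x : ℝ} (hf : x ≤ c → HasDerivAt f (f' x) x)
    (hg : c ≤ x → HasDerivAt g (g' x) x) (h0 : f c = g c) (h1 : x = c → f' c = g' c) :
    HasDerivAt (fun x => if x < c then f x else g x) (if x < c then f' x else g' x) x := by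
  rcases lt_trichotomy x c with hx | rfl | hx
  · rw [if_pos hx]
    refine (hf hx.le).congr_of_eventuallyEq ?_
    filter_upwards [Iio_mem_nhds hx] with y hy
    exact if_pos hy
  · rw [if_neg (lt_irrefl _)]
    have hL : HasDerivWithinAt (fun y => if y < x then f y else g y) (g' x) (Iic x) x := by
      rw [← h1 rfl]
      refine (hf le_rfl).hasDerivWithinAt.congr (fun y hy => ?_) ?_
      · rcases (show y ≤ x from hy).lt_or_eq with h | rfl
        · exact if_pos h
        · simp [h0]
      · simp [h0]
    have hR : HasDerivWithinAt (fun y => if y < x then f y else g y) (g' x) (Ici x) x := by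
      refine (hg le_rfl).hasDerivWithinAt.congr (fun y hy => ?_) ?_
      · exact if_neg (not_lt.2 hy)
      · simp
    have := hL.union hR
    rwa [Iic_union_Ici, hasDerivWithinAt_univ] at this
  · rw [if_neg hx.le.not_gt]
    refine (hg hx.le).congr_of_eventuallyEq ?_
    filter_upwards [Ioi_mem_nhds hx] with y hy
    exact if_neg (not_lt.2 (le_of_lt hy))

/-- `F 0` is three times continuously differentiable with derivatives `F 1`, `F 2`, `F 3`, and the
derivative of `F 3` outside of the set `s` is `F 4`. -/
structure IsJet (s : Set ℝ) (F : ℕ → ℝ → ℝ) : Prop where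
  hasDerivAt : ∀ j < 3, ∀ x, HasDerivAt (F j) (F (j + 1) x) x
  continuous_three : Continuous (F 3)
  hasDerivAt_three : ∀ x ∉ s, HasDerivAt (F 3) (F 4 x) x

/-- The family `F` to the left of `c` and the family `H` from `c` on. -/
noncomputable def glueAt (c : ℝ) (F H : ℕ → ℝ → ℝ) (j : ℕ) (x : ℝ) : ℝ :=
  if x < c then F j x else H j x

/-- The derivatives of the reflected function `x ↦ F 0 (-x)`. -/
noncomputable def reflectJet (F : ℕ → ℝ → ℝ) (j : ℕ) (x : ℝ) : ℝ := (-1) ^ j * F j (-x)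

theorem IsJet.of_hasDerivAt {F : ℕ → ℝ → ℝ} (h : ∀ j < 4, ∀ x, HasDerivAt (F j) (F (j + 1) x) x) :
    IsJet ∅ F where
  hasDerivAt j hj := h j (by omega)
  continuous_three := continuous_iff_continuousAt.2 fun x => (h 3 (by norm_num) x).continuousAt
  hasDerivAt_three x _ := h 3 (by norm_num) x

theorem IsJet.continuous {s : Set ℝ} {F : ℕ → ℝ → ℝ} (h : IsJet s F) {j : ℕ} (hj : j ≤ 3) :
    Continuous (F j) := by
  rcases hj.lt_or_eq with hj | rfl
  · exact continuous_iff_continuousAt.2 fun x => (h.hasDerivAt j hj x).continuousAt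
  · exact h.continuous_three

theorem IsJet.glueAt {s t : Set ℝ} {F H : ℕ → ℝ → ℝ} (hF : IsJet s F) (hH : IsJet t H) {c : ℝ}
    (hc : ∀ j ≤ 3, F j c = H j c) : IsJet (insert c (s ∪ t)) (glueAt c F H) where
  hasDerivAt j hj x := hasDerivAt_ite_lt (fun _ => hF.hasDerivAt j hj x)
    (fun _ => hH.hasDerivAt j hj x) (hc j hj.le) (fun _ => hc (j + 1) hj)
  continuous_three := by
    refine Continuous.if_le (f' := fun x => H 3 x) (g' := fun x => F 3 x) (f := fun _ => c)
      (g := fun x => x) hH.continuous_three hF.continuous_three continuous_const continuous_id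
      (fun x hx => ?_) |>.congr fun x => ?_
    · rw [← hx, hc 3 le_rfl]
    · by_cases h : x < c
      · simp [_root_.glueAt, h, not_le.2 h]
      · simp [_root_.glueAt, h, not_lt.1 h]
  hasDerivAt_three x hx := by
    simp only [mem_insert_iff, mem_union, not_or] at hx
    exact hasDerivAt_ite_lt (fun _ => hF.hasDerivAt_three x hx.2.1)
      (fun _ => hH.hasDerivAt_three x hx.2.2) (hc 3 le_rfl) (fun h => absurd h hx.1)

theorem IsJet.reflectJet {F : ℕ → ℝ → ℝ} (hF : IsJet ∅ F) : IsJet ∅ (reflectJet F) := by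
  refine IsJet.of_hasDerivAt fun j hj x => ?_
  have h : HasDerivAt (F j) (F (j + 1) (-x)) (-x) := by
    rcases (show j ≤ 3 by omega).lt_or_eq with h | rfl
    · exact hF.hasDerivAt j h _
    · exact hF.hasDerivAt_three _ (by simp)
  have h2 := ((h.scomp x (hasDerivAt_neg x)).const_mul ((-1) ^ j))
  refine h2.congr_deriv ?_
  change (-1) ^ j * ((-1 : ℝ) * F (j + 1) (-x)) = (-1) ^ (j + 1) * F (j + 1) (-x)
  ring

theorem IsJet.iteratedDeriv_eq {s : Set ℝ} {F : ℕ → ℝ → ℝ} (h : IsJet s F) :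
    ∀ j ≤ 3, iteratedDeriv j (F 0) = F j
  | 0, _ => iteratedDeriv_zero
  | j + 1, hj => by
    rw [iteratedDeriv_succ, h.iteratedDeriv_eq j (by omega)]
    exact funext fun x => (h.hasDerivAt j (by omega) x).deriv

theorem IsJet.iteratedDeriv_four {s : Set ℝ} {F : ℕ → ℝ → ℝ} (h : IsJet s F) {x : ℝ}
    (hx : x ∉ s) : iteratedDeriv 4 (F 0) x = F 4 x := by
  rw [iteratedDeriv_succ, h.iteratedDeriv_eq 3 le_rfl]
  exact (h.hasDerivAt_three x hx).deriv

theorem IsJet.contDiff {s : Set ℝ} {F : ℕ → ℝ → ℝ} (h : IsJet s F) : ContDiff ℝ 3 (F 0) := by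
  have := contDiff_iff_iteratedDeriv (𝕜 := ℝ) (f := F 0) (n := 3)
  refine this.2 ⟨fun m hm => ?_, fun m hm => ?_⟩
  · have hm : m ≤ 3 := by exact_mod_cast hm
    rw [h.iteratedDeriv_eq m hm]
    exact h.continuous hm
  · have hm : m < 3 := by exact_mod_cast hm
    rw [h.iteratedDeriv_eq m hm.le]
    exact fun x => (h.hasDerivAt m hm x).differentiableAt

/-- Integration by parts on `[-n, n]`. Continuity of `u` permits a countable exceptional set, and
the boundary terms vanish because `u` is bounded and the test function decays. -/
theorem lineDerivOp_toLp_eq {u u' : ℝ → ℝ} {s : Set ℝ} (hs : s.Countable)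
    (hu : MemLp (fun x => (u x : ℂ)) 2 volume) (hu' : MemLp (fun x => (u' x : ℂ)) 2 volume)
    (hc : Continuous u) {K : ℝ} (hK : ∀ x, |u x| ≤ K)
    (hd : ∀ x ∉ s, HasDerivAt u (u' x) x) :
    ∂_{(1 : ℝ)} ((hu.toLp _ : L2R) : 𝓢'(ℝ, ℂ)) = ((hu'.toLp _ : L2R) : 𝓢'(ℝ, ℂ)) := by
  ext φ
  rw [TemperedDistribution.lineDerivOp_apply_apply, lineDerivOp_one_eq,
    Lp.toTemperedDistribution_apply, Lp.toTemperedDistribution_apply]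
  have hi : Integrable (fun x => schwartzD φ x * (u x : ℂ)) volume :=
    ((schwartzD φ).memLp 2 volume).integrable_mul hu
  have hi' : Integrable (fun x => φ x * (u' x : ℂ)) volume :=
    (φ.memLp 2 volume).integrable_mul hu'
  have h1 : (∫ x, (-schwartzD φ) x • (hu.toLp _ : L2R) x) = -∫ x, schwartzD φ x * (u x : ℂ) := by
    rw [← integral_neg]
    refine integral_congr_ae ?_
    filter_upwards [hu.coeFn_toLp] with x hx
    rw [hx, neg_apply, smul_eq_mul, neg_mul]
  have h2 : (∫ x, φ x • (hu'.toLp _ : L2R) x) = ∫ x, φ x * (u' x : ℂ) := by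
    refine integral_congr_ae ?_
    filter_upwards [hu'.coeFn_toLp] with x hx
    rw [hx, smul_eq_mul]
  rw [h1, h2, neg_eq_iff_add_eq_zero, ← integral_add hi hi']
  have hcu : Continuous fun x => φ x * (u x : ℂ) :=
    φ.continuous.mul (Complex.continuous_ofReal.comp hc)
  have hint : ∀ n : ℕ, (∫ x in (-(n : ℝ))..n, (schwartzD φ x * (u x : ℂ) + φ x * (u' x : ℂ))) =
      φ n * (u n : ℂ) - φ (-(n : ℝ)) * (u (-(n : ℝ)) : ℂ) := by
    intro n
    refine integral_eq_of_hasDerivAt_off_countable (fun x => φ x * (u x : ℂ)) _ hs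
      hcu.continuousOn (fun x hx => ?_) (hi.add hi').intervalIntegrable
    have := (φ.hasDerivAt x).mul (hd x hx.2).ofReal_comp
    rwa [SchwartzMap.derivCLM_apply]
  have hl := intervalIntegral_tendsto_integral (hi.add hi')
    (tendsto_neg_atTop_atBot.comp tendsto_natCast_atTop_atTop)
    (tendsto_natCast_atTop_atTop (R := ℝ))
  have hz : Tendsto (fun x => φ x * (u x : ℂ)) (cocompact ℝ) (𝓝 0) := by
    have h3 : Tendsto φ (cocompact ℝ) (𝓝 0) := φ.toZeroAtInfty.zero_at_infty'
    have h4 : Tendsto (fun x => ‖φ x‖ * K) (cocompact ℝ) (𝓝 0) := by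
      simpa using h3.norm.mul_const K
    refine squeeze_zero_norm (fun x => ?_) h4
    rw [norm_mul, Complex.norm_real]
    exact mul_le_mul_of_nonneg_left (hK x) (norm_nonneg _)
  have hr : Tendsto (fun n : ℕ => φ n * (u n : ℂ) - φ (-(n : ℝ)) * (u (-(n : ℝ)) : ℂ)) atTop
      (𝓝 0) := by
    rw [← sub_zero (0 : ℂ)]
    refine Tendsto.sub (hz.comp ?_) (hz.comp (f := fun n : ℕ => -(n : ℝ)) ?_)
    · exact (tendsto_natCast_atTop_atTop (R := ℝ)).mono_right atTop_le_cocompact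
    · exact (tendsto_neg_atTop_atBot.comp (tendsto_natCast_atTop_atTop (R := ℝ))).mono_right
        atBot_le_cocompact
  refine tendsto_nhds_unique hl (hr.congr fun n => (hint n).symm)

theorem IsJet.fourthDistDeriv_toLp {s : Set ℝ} (hs : s.Countable) {F : ℕ → ℝ → ℝ} (h : IsJet s F)
    (hF : ∀ j ≤ 4, MemLp (fun x => (F j x : ℂ)) 2 volume) {K : ℝ} (hK : ∀ j ≤ 4, ∀ x, |F j x| ≤ K) :
    fourthDistDeriv (((hF 0 (by norm_num)).toLp _ : L2R) : 𝓢'(ℝ, ℂ)) =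
      (((hF 4 le_rfl).toLp _ : L2R) : 𝓢'(ℝ, ℂ)) := by
  have step : ∀ j (hj : j < 3),
      ∂_{(1 : ℝ)} (((hF j (by omega)).toLp _ : L2R) : 𝓢'(ℝ, ℂ)) =
        (((hF (j + 1) (by omega)).toLp _ : L2R) : 𝓢'(ℝ, ℂ)) := fun j hj =>
    lineDerivOp_toLp_eq hs _ _ (h.continuous hj.le) (hK j (by omega))
      (fun x _ => h.hasDerivAt j hj x)
  rw [fourthDistDeriv, step 0 (by norm_num), step 1 (by norm_num), step 2 (by norm_num)]
  exact lineDerivOp_toLp_eq hs _ _ h.continuous_three (hK 3 (by norm_num)) h.hasDerivAt_three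

theorem integrable_exp_neg_mul_abs {m : ℝ} (hm : 0 < m) :
    Integrable (fun x : ℝ => Real.exp (-m * |x|)) volume := by
  refine (integrable_inv_one_add_sq.const_mul (1 + 2 / m ^ 2)).mono'
    (by fun_prop) (Eventually.of_forall fun x => ?_)
  rw [Real.norm_of_nonneg (by positivity), neg_mul, Real.exp_neg, ← div_eq_mul_inv,
    inv_le_comm₀ (by positivity) (by positivity), inv_div, div_le_iff₀ (by positivity)]
  -- Comparison with `1 + x²` through `exp t ≥ 1 + t + t²/2` at `t = m|x|`; the factor `1 + 2/m²`
  -- makes the product dominate both `1` and `x²`.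
  have h1 := Real.quadratic_le_exp_of_nonneg (show 0 ≤ m * |x| by positivity)
  have h2 : 1 + x ^ 2 ≤ (1 + m * |x| + (m * |x|) ^ 2 / 2) * (1 + 2 / m ^ 2) := by
    have h3 : (1 + m * |x| + (m * |x|) ^ 2 / 2) * (1 + 2 / m ^ 2) =
        1 + x ^ 2 + (m * |x| + m ^ 2 * x ^ 2 / 2 + 2 / m ^ 2 + 2 * |x| / m) := by
      rw [← sq_abs x]
      field_simp
      ring
    rw [h3]
    have : 0 ≤ m * |x| + m ^ 2 * x ^ 2 / 2 + 2 / m ^ 2 + 2 * |x| / m := by positivity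
    linarith
  exact h2.trans (by gcongr)

theorem memLp_two_of_le_exp {f : ℝ → ℝ} (hf : AEStronglyMeasurable f volume) {k K : ℝ} (hk : 0 < k)
    (h : ∀ x, |f x| ≤ K * Real.exp (-k * |x|)) : MemLp (fun x => (f x : ℂ)) 2 volume := by
  have hm : AEStronglyMeasurable (fun x => (f x : ℂ)) volume :=
    Complex.continuous_ofReal.comp_aestronglyMeasurable hf
  rw [memLp_two_iff_integrable_sq_norm hm]
  have hi : Integrable (fun x : ℝ => K ^ 2 * Real.exp (-(2 * k) * |x|)) volume :=
    (integrable_exp_neg_mul_abs (by positivity)).const_mul _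
  refine hi.mono' (hm.norm.pow 2) (Eventually.of_forall fun x => ?_)
  rw [Real.norm_of_nonneg (by positivity), Complex.norm_real, Real.norm_eq_abs]
  calc |f x| ^ 2 ≤ (K * Real.exp (-k * |x|)) ^ 2 := by gcongr; exact h x
    _ = K ^ 2 * Real.exp (-(2 * k) * |x|) := by
      rw [mul_pow, ← Real.exp_nat_mul]
      congr 2
      push_cast
      ring

end Jets

/-! ### Explicit solutions on the pieces and the matching conditions -/

section Pieces

open Real

/-- The derivatives of `x ↦ exp (k * x)`. -/
noncomputable def expJet (k : ℝ) (j : ℕ) (x : ℝ) : ℝ := k ^ j * exp (k * x)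

theorem hasDerivAt_expJet (k : ℝ) (j : ℕ) (x : ℝ) :
    HasDerivAt (expJet k j) (expJet k (j + 1) x) x := by
  have h := (((hasDerivAt_id x).const_mul k).exp).const_mul (k ^ j)
  refine h.congr_deriv ?_
  simp only [expJet, id, pow_succ]
  ring

/-- The solution of `f'''' = -4 α⁴ f` with `f⁽ʲ⁾(0) = αʲ yⱼ` for `j ≤ 3`. -/
noncomputable def quarticSol (α y₀ y₁ y₂ y₃ x : ℝ) : ℝ :=
  y₀ * (cosh (α * x) * cos (α * x)) +
    y₁ * ((cosh (α * x) * sin (α * x) + sinh (α * x) * cos (α * x)) / 2) +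
    y₂ * (sinh (α * x) * sin (α * x) / 2) +
    y₃ * ((cosh (α * x) * sin (α * x) - sinh (α * x) * cos (α * x)) / 4)

/-- In this basis differentiation shifts the data `(y₀, y₁, y₂, y₃)` to `(y₁, y₂, y₃, -4y₀)`, up to
the factor `α`. -/
theorem hasDerivAt_quarticSol (α y₀ y₁ y₂ y₃ x : ℝ) :
    HasDerivAt (quarticSol α y₀ y₁ y₂ y₃) (α * quarticSol α y₁ y₂ y₃ (-4 * y₀) x) x := by
  have h : HasDerivAt (fun x => α * x) (α * 1) x := (hasDerivAt_id x).const_mul α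
  have hc := h.cos
  have hs := h.sin
  have hC := h.cosh
  have hS := h.sinh
  have h1 := (((hC.fun_mul hc).const_mul y₀).fun_add
    ((((hC.fun_mul hs).fun_add (hS.fun_mul hc)).div_const 2).const_mul y₁)).fun_add
    (((hS.fun_mul hs).div_const 2).const_mul y₂) |>.fun_add
    ((((hC.fun_mul hs).fun_sub (hS.fun_mul hc)).div_const 4).const_mul y₃)
  refine h1.congr_deriv ?_
  simp only [quarticSol]
  ring

/-- The derivatives of the solution of `f'''' = -4 α⁴ f` with `f⁽ʲ⁾(a) = αʲ yⱼ` for `j ≤ 3`. -/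
noncomputable def midJet (α a y₀ y₁ y₂ y₃ : ℝ) : ℕ → ℝ → ℝ
  | 0, x => quarticSol α y₀ y₁ y₂ y₃ (x - a)
  | 1, x => α * quarticSol α y₁ y₂ y₃ (-4 * y₀) (x - a)
  | 2, x => α ^ 2 * quarticSol α y₂ y₃ (-4 * y₀) (-4 * y₁) (x - a)
  | 3, x => α ^ 3 * quarticSol α y₃ (-4 * y₀) (-4 * y₁) (-4 * y₂) (x - a)
  | _, x => -4 * α ^ 4 * quarticSol α y₀ y₁ y₂ y₃ (x - a)

theorem isJet_midJet (α a y₀ y₁ y₂ y₃ : ℝ) : IsJet ∅ (midJet α a y₀ y₁ y₂ y₃) := by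
  refine IsJet.of_hasDerivAt fun j hj x => ?_
  have h : ∀ c z₀ z₁ z₂ z₃ : ℝ, HasDerivAt (fun x => c * quarticSol α z₀ z₁ z₂ z₃ (x - a))
      (c * (α * quarticSol α z₁ z₂ z₃ (-4 * z₀) (x - a))) x := fun c z₀ z₁ z₂ z₃ =>
    ((hasDerivAt_quarticSol α z₀ z₁ z₂ z₃ (x - a)).comp_sub_const x a).const_mul c
  interval_cases j
  · have := h 1 y₀ y₁ y₂ y₃
    simp only [one_mul] at this
    exact this
  · exact (h α y₁ y₂ y₃ (-4 * y₀)).congr_deriv (by simp only [midJet]; ring)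
  · exact (h (α ^ 2) y₂ y₃ (-4 * y₀) (-4 * y₁)).congr_deriv (by simp only [midJet]; ring)
  · exact (h (α ^ 3) y₃ (-4 * y₀) (-4 * y₁) (-4 * y₂)).congr_deriv (by
      simp only [midJet, quarticSol]; ring)

theorem continuous_midJet (α a y₀ y₁ y₂ y₃ : ℝ) (j : ℕ) :
    Continuous (midJet α a y₀ y₁ y₂ y₃ j) := by
  have h : ∀ c z₀ z₁ z₂ z₃ : ℝ, Continuous (fun x => c * quarticSol α z₀ z₁ z₂ z₃ (x - a)) := by
    intro c z₀ z₁ z₂ z₃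
    unfold quarticSol
    fun_prop
  match j with
  | 0 => exact (h 1 y₀ y₁ y₂ y₃).congr fun x => one_mul _
  | 1 => exact h α y₁ y₂ y₃ (-4 * y₀)
  | 2 => exact h (α ^ 2) y₂ y₃ (-4 * y₀) (-4 * y₁)
  | 3 => exact h (α ^ 3) y₃ (-4 * y₀) (-4 * y₁) (-4 * y₂)
  | _ + 4 => exact h (-4 * α ^ 4) y₀ y₁ y₂ y₃

/-- The derivatives of `x ↦ c₁ cosh (β x) + c₂ cos (β x)`. -/
noncomputable def innerJet (β c₁ c₂ : ℝ) : ℕ → ℝ → ℝ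
  | 0, x => c₁ * cosh (β * x) + c₂ * cos (β * x)
  | 1, x => β * (c₁ * sinh (β * x) - c₂ * sin (β * x))
  | 2, x => β ^ 2 * (c₁ * cosh (β * x) - c₂ * cos (β * x))
  | 3, x => β ^ 3 * (c₁ * sinh (β * x) + c₂ * sin (β * x))
  | _, x => β ^ 4 * (c₁ * cosh (β * x) + c₂ * cos (β * x))

theorem isJet_innerJet (β c₁ c₂ : ℝ) : IsJet ∅ (innerJet β c₁ c₂) := by
  refine IsJet.of_hasDerivAt fun j hj x => ?_
  have h : HasDerivAt (fun x => β * x) (β * 1) x := (hasDerivAt_id x).const_mul β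
  have hc := h.cos
  have hs := h.sin
  have hC := h.cosh
  have hS := h.sinh
  interval_cases j
  · exact ((hC.const_mul c₁).add (hc.const_mul c₂)).congr_deriv (by simp only [innerJet]; ring)
  · exact (((hS.const_mul c₁).sub (hs.const_mul c₂)).const_mul β).congr_deriv (by
      simp only [innerJet]; ring)
  · exact (((hC.const_mul c₁).sub (hc.const_mul c₂)).const_mul (β ^ 2)).congr_deriv (by
      simp only [innerJet]; ring)
  · exact (((hS.const_mul c₁).add (hs.const_mul c₂)).const_mul (β ^ 3)).congr_deriv (by
      simp only [innerJet]; ring)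

theorem continuous_innerJet (β c₁ c₂ : ℝ) (j : ℕ) : Continuous (innerJet β c₁ c₂ j) := by
  match j with
  | 0 => exact (by fun_prop : Continuous fun x => c₁ * cosh (β * x) + c₂ * cos (β * x))
  | 1 => exact (by fun_prop : Continuous fun x => β * (c₁ * sinh (β * x) - c₂ * sin (β * x)))
  | 2 => exact (by fun_prop : Continuous fun x => β ^ 2 * (c₁ * cosh (β * x) - c₂ * cos (β * x)))
  | 3 => exact (by fun_prop : Continuous fun x => β ^ 3 * (c₁ * sinh (β * x) + c₂ * sin (β * x)))
  | _ + 4 =>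
    exact (by fun_prop : Continuous fun x => β ^ 4 * (c₁ * cosh (β * x) + c₂ * cos (β * x)))

theorem innerJet_neg (β c₁ c₂ : ℝ) : ∀ j ≤ 4, ∀ x : ℝ,
    innerJet β c₁ c₂ j (-x) = (-1) ^ j * innerJet β c₁ c₂ j x := by
  intro j hj x
  interval_cases j <;> simp [innerJet] <;> ring

/-- Up to the factor `c αʲ`, the middle piece has data `G0, G1, r G1, G3` at `b`. The first and
third derivatives of the inner piece there are `-β c₁ sinh π` and `-β³ c₁ sinh π`, which forces `G3
= y² G1`. Eliminating `c₁, c₂` from the orders `0, 1, 2` leaves the second equation, here multiplied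
by `G1` so that `G3` can replace `y² G1`. -/
theorem exists_matching_parameters : ∃ r y : ℝ, 0 < r ∧ 0 < y ∧
    y ^ 2 * (-sinh π - r * cosh π - r ^ 2 * sinh π / 2) =
      2 * sinh π - r ^ 2 * sinh π - r ^ 3 * cosh π ∧
    2 * y * (-sinh π - r * cosh π - r ^ 2 * sinh π / 2) ^ 2 * cosh π +
      sinh π * ((-cosh π - r * sinh π / 2 + r ^ 3 * sinh π / 4) *
        (2 * sinh π - r ^ 2 * sinh π - r ^ 3 * cosh π) +
        r * (-sinh π - r * cosh π - r ^ 2 * sinh π / 2) ^ 2) = 0 := by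
  have hS : 3 < sinh π := pi_gt_three.trans (self_lt_sinh_iff.2 pi_pos)
  have hSC : sinh π < cosh π := sinh_lt_cosh π
  have hC2 : cosh π ≤ 2 * sinh π := by nlinarith [cosh_sq π]
  generalize sinh π = S at *
  generalize cosh π = C at *
  have hS0 : 0 < S := by linarith
  have hC0 : 0 < C := by linarith
  let G1 : ℝ → ℝ := fun r => -S - r * C - r ^ 2 * S / 2
  let G3 : ℝ → ℝ := fun r => 2 * S - r ^ 2 * S - r ^ 3 * C
  let G0 : ℝ → ℝ := fun r => -C - r * S / 2 + r ^ 3 * S / 4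
  let f : ℝ → ℝ := fun r => 2 * √(G3 r / G1 r) * G1 r ^ 2 * C + S * (G0 r * G3 r + r * G1 r ^ 2)
  have hG1 : ∀ r, 0 < r → G1 r < 0 := by
    intro r hr
    have : 0 < r * C + r ^ 2 * S / 2 := by positivity
    simp only [G1]
    linarith
  -- From `√2` on, both `G1` and `G3` are negative, so `y = √(G3 / G1)` is legitimate; at `√2`
  -- itself the `S` terms of `G0` cancel and every term of `f` is nonnegative.
  have h2 : √2 ^ 2 = (2 : ℝ) := sq_sqrt (by norm_num)
  have h2pos : (0 : ℝ) < √2 := by positivity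
  have h210 : √2 ≤ (10 : ℝ) := by nlinarith
  have hG3 : ∀ r, √2 ≤ r → G3 r < 0 := by
    intro r hr
    have h1 : 2 ≤ r ^ 2 := by rw [← h2]; gcongr
    have hr0 := h2pos.trans_le hr
    have h3 : 0 < r ^ 3 * C := by positivity
    simp only [G3]
    nlinarith
  have hfc : ContinuousOn f (Icc (√2) 10) := by
    have h1 : Continuous G1 := by fun_prop
    have h3 : Continuous G3 := by fun_prop
    have h0 : Continuous G0 := by fun_prop
    have hd : ContinuousOn (fun r => √(G3 r / G1 r)) (Icc (√2) 10) :=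
      (h3.continuousOn.div h1.continuousOn fun r hr =>
        (hG1 r (h2pos.trans_le hr.1)).ne).sqrt
    exact ((hd.const_mul 2).mul (by fun_prop) |>.mul continuousOn_const).add (by fun_prop)
  have hpos : 0 ≤ f (√2) := by
    have h1 : G0 (√2) = -C := by
      simp only [G0]
      have : √2 ^ 3 = 2 * √2 := by rw [pow_succ, h2]
      rw [this]; ring
    have h3 : 0 ≤ G0 (√2) * G3 (√2) :=
      mul_nonneg_of_nonpos_of_nonpos (by rw [h1]; linarith) (hG3 _ le_rfl).le
    simp only [f]
    positivity
  -- At `r = 10` the cubic term makes `G0` positive while `G3` is negative. With `S < C ≤ 2S` the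
  -- product `S G0 G3` outweighs the positive terms, all being compared with multiples of `S³`.
  have hneg : f 10 ≤ 0 := by
    have h1 : G1 10 = -(51 * S + 10 * C) := by simp only [G1]; ring
    have h3 : G3 10 = -(98 * S + 1000 * C) := by simp only [G3]; ring
    have h0 : G0 10 = 245 * S - C := by simp only [G0]; ring
    have hy : √(G3 10 / G1 10) ≤ 6 := by
      rw [sqrt_le_left (by norm_num), h1, h3, neg_div_neg_eq, div_le_iff₀ (by positivity)]
      linarith
    have hG1sq : G1 10 ^ 2 ≤ (71 * S) ^ 2 := by
      rw [h1, neg_sq]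
      gcongr
      linarith
    have hA : 2 * √(G3 10 / G1 10) * G1 10 ^ 2 * C ≤ 2 * 6 * (71 * S) ^ 2 * (2 * S) := by
      gcongr
    have hB : G0 10 * G3 10 ≤ -(243 * S * (1098 * S)) := by
      rw [h0, h3, mul_neg, neg_le_neg_iff]
      have : 0 ≤ 98 * S + 1000 * C := by positivity
      gcongr <;> linarith
    have hB' : S * (G0 10 * G3 10 + 10 * G1 10 ^ 2) ≤
        S * (-(243 * S * (1098 * S)) + 10 * (71 * S) ^ 2) := by gcongr
    have hS3 : 0 < S ^ 3 := by positivity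
    simp only [f]
    nlinarith
  obtain ⟨r, hr, hfr⟩ := intermediate_value_Icc' h210 hfc ⟨hneg, hpos⟩
  have hr0 : 0 < r := h2pos.trans_le hr.1
  have hq : 0 < G3 r / G1 r := div_pos_of_neg_of_neg (hG3 r hr.1) (hG1 r hr0)
  refine ⟨r, √(G3 r / G1 r), hr0, sqrt_pos.2 hq, ?_, hfr⟩
  rw [sq_sqrt hq.le]
  exact div_mul_cancel₀ _ (hG1 r hr0).ne

theorem midJet_left (α a r c : ℝ) : ∀ j ≤ 3,
    midJet α a c (c * r) (c * r ^ 2) (c * r ^ 3) j a = (α * r) ^ j * c := by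
  intro j hj
  interval_cases j <;> simp [midJet, quarticSol] <;> ring

theorem midJet_eq_innerJet {α a b r y c : ℝ} (hy : y ≠ 0) (hb : α * (b - a) = π)
    (hβ : y * α * b = -π)
    (h1 : y ^ 2 * (-sinh π - r * cosh π - r ^ 2 * sinh π / 2) =
      2 * sinh π - r ^ 2 * sinh π - r ^ 3 * cosh π)
    (h2 : 2 * y * (-sinh π - r * cosh π - r ^ 2 * sinh π / 2) ^ 2 * cosh π +
      sinh π * ((-cosh π - r * sinh π / 2 + r ^ 3 * sinh π / 4) *
        (2 * sinh π - r ^ 2 * sinh π - r ^ 3 * cosh π) +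
        r * (-sinh π - r * cosh π - r ^ 2 * sinh π / 2) ^ 2) = 0) (hr : 0 < r) :
    ∃ c₁ c₂ : ℝ, ∀ j ≤ 3, midJet α a c (c * r) (c * r ^ 2) (c * r ^ 3) j b =
      innerJet (y * α) c₁ c₂ j b := by
  have hS : 0 < sinh π := sinh_pos_iff.2 pi_pos
  have hC : 0 < cosh π := cosh_pos π
  have hG1 : -sinh π - r * cosh π - r ^ 2 * sinh π / 2 ≠ 0 := by
    have : 0 < sinh π + r * cosh π + r ^ 2 * sinh π / 2 := by positivity
    linarith
  have hsol : ∀ z₀ z₁ z₂ z₃, quarticSol α z₀ z₁ z₂ z₃ (b - a) =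
      -z₀ * cosh π - z₁ * sinh π / 2 + z₃ * sinh π / 4 := by
    intro z₀ z₁ z₂ z₃
    simp only [quarticSol, hb, sin_pi, cos_pi]
    ring
  set S := sinh π
  set C := cosh π
  have h3 : -2 * (-S - r * C - r ^ 2 * S / 2) * C =
      y * S * (-C - r * S / 2 + r ^ 3 * S / 4) +
        S * r * (-S - r * C - r ^ 2 * S / 2) / y := by
    rw [← h1] at h2
    field_simp
    have h4 : (-S - r * C - r ^ 2 * S / 2) *
        (2 * y * (-S - r * C - r ^ 2 * S / 2) * C +
          S * ((-C - r * S / 2 + r ^ 3 * S / 4) * y ^ 2 +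
            r * (-S - r * C - r ^ 2 * S / 2))) = 0 := by
      linarith
    have h5 := (mul_eq_zero.1 h4).resolve_left hG1
    linarith
  set G := -S - r * C - r ^ 2 * S / 2 with hG
  -- The condition on the first derivative determines `c₁`, and that on the value then determines
  -- `c₂`. The remaining two orders are `h4` and `h1`.
  refine ⟨-(c * G) / (y * S), -(c * G) / (y * S) * C - c * (-C - r * S / 2 + r ^ 3 * S / 4),
    fun j hj => ?_⟩
  have h4 : y * S * (r * G) = -2 * y ^ 2 * G * C - y ^ 3 * S * (-C - r * S / 2 + r ^ 3 * S / 4) := by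
    have : y * (S * r * G / y) = S * r * G := by field_simp
    linear_combination (-y ^ 2) * h3 - y * this
  interval_cases j
  · simp only [midJet, innerJet, hsol, hβ, cosh_neg, cos_neg, cos_pi]
    ring
  · simp only [midJet, innerJet, hsol, hβ, sinh_neg, sin_neg, sin_pi]
    field_simp
    rw [hG]; ring
  · simp only [midJet, innerJet, hsol, hβ, cosh_neg, cos_neg, cos_pi]
    have key : r * G = y ^ 2 * (2 * (-G / (y * S)) * C - (-C - r * S / 2 + r ^ 3 * S / 4)) := by
      have hyS : y * S ≠ 0 := mul_ne_zero hy hS.ne'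
      apply mul_left_cancel₀ hyS
      have e : y * S * (-G / (y * S)) = -G := mul_div_cancel₀ _ hyS
      linear_combination h4 - 2 * y ^ 2 * C * e
    linear_combination (α ^ 2 * c) * key - (α ^ 2 * c * r) * hG
  · simp only [midJet, innerJet, hsol, hβ, sinh_neg, sin_neg, sin_pi]
    have key : y ^ 3 * (c * G / (y * S) * S) = c * y ^ 2 * G := by field_simp
    linear_combination -(α ^ 3 * c) * h1 - α ^ 3 * key

end Pieces

/-! ### Even gluing of the pieces -/

section SymmetricGlue

/-- For `a < b < 0`: the families `E`, `M`, `N` on `(-∞, a)`, `[a, b)` and `[b, -b)`, continued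
to the right by reflection. -/
noncomputable def symGlue (a b : ℝ) (E M N : ℕ → ℝ → ℝ) : ℕ → ℝ → ℝ :=
  glueAt a E (glueAt b M (glueAt (-b) N (glueAt (-a) (reflectJet M) (reflectJet E))))

variable {a b : ℝ} {E M N : ℕ → ℝ → ℝ}

theorem symGlue_of_lt {j : ℕ} {x : ℝ} (h : x < a) : symGlue a b E M N j x = E j x := if_pos h

theorem symGlue_of_mem_left {j : ℕ} {x : ℝ} (h1 : a ≤ x) (h2 : x < b) :
    symGlue a b E M N j x = M j x := by
  simp [symGlue, glueAt, h1.not_gt, h2]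

theorem symGlue_of_mem_middle {j : ℕ} {x : ℝ} (hab : a < b) (h1 : b ≤ x) (h2 : x < -b) :
    symGlue a b E M N j x = N j x := by
  simp [symGlue, glueAt, (hab.le.trans h1).not_gt, h1.not_gt, h2]

theorem symGlue_of_mem_right {j : ℕ} {x : ℝ} (hab : a < b) (hb : b < 0) (h1 : -b ≤ x)
    (h2 : x < -a) : symGlue a b E M N j x = (-1) ^ j * M j (-x) := by
  have h3 : ¬ x < a := by linarith
  have h4 : ¬ x < b := by linarith
  simp [symGlue, glueAt, reflectJet, h1.not_gt, h2, h3, h4]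

theorem symGlue_of_le {j : ℕ} {x : ℝ} (hab : a < b) (hb : b < 0) (h1 : -a ≤ x) :
    symGlue a b E M N j x = (-1) ^ j * E j (-x) := by
  have h3 : ¬ x < a := by linarith
  have h4 : ¬ x < b := by linarith
  have h5 : ¬ x < -b := by linarith
  simp [symGlue, glueAt, reflectJet, h1.not_gt, h3, h4, h5]

theorem symGlue_cases (a b x : ℝ) :
    x < a ∨ (a ≤ x ∧ x < b) ∨ (b ≤ x ∧ x < -b) ∨ (-b ≤ x ∧ x < -a) ∨ -a ≤ x := by
  rcases lt_or_ge x a with h | h1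
  · exact Or.inl h
  rcases lt_or_ge x b with h | h2
  · exact Or.inr (Or.inl ⟨h1, h⟩)
  rcases lt_or_ge x (-b) with h | h3
  · exact Or.inr (Or.inr (Or.inl ⟨h2, h⟩))
  rcases lt_or_ge x (-a) with h | h4
  · exact Or.inr (Or.inr (Or.inr (Or.inl ⟨h3, h⟩)))
  · exact Or.inr (Or.inr (Or.inr (Or.inr h4)))

theorem isJet_symGlue (hab : a < b) (hb : b < 0) (hE : IsJet ∅ E) (hM : IsJet ∅ M)
    (hN : IsJet ∅ N) (hEM : ∀ j ≤ 3, E j a = M j a) (hMN : ∀ j ≤ 3, M j b = N j b)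
    (hNs : ∀ j ≤ 4, ∀ x, N j (-x) = (-1) ^ j * N j x) :
    IsJet {a, b, -b, -a} (symGlue a b E M N) := by
  have h1 := hM.reflectJet.glueAt hE.reflectJet (c := -a) fun j hj => by
    simp [reflectJet, hEM j hj]
  have h2 := hN.glueAt h1 (c := -b) fun j hj => by
    have : -b < -a := by linarith
    simp [glueAt, reflectJet, this, hNs j (by omega), hMN j hj]
  have h3 := hM.glueAt h2 (c := b) fun j hj => by
    have : b < -b := by linarith
    simp [glueAt, this, hMN j hj]
  have h4 := hE.glueAt h3 (c := a) fun j hj => by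
    simp [glueAt, hab, hEM j hj]
  simp only [empty_union, union_empty, insert_empty_eq] at h4
  exact h4

theorem symGlue_zero_neg (hab : a < b) (hb : b < 0) (hEM : E 0 a = M 0 a) (hMN : M 0 b = N 0 b)
    (hNs : ∀ x, N 0 (-x) = N 0 x) (x : ℝ) :
    symGlue a b E M N 0 (-x) = symGlue a b E M N 0 x := by
  suffices h : ∀ x, 0 ≤ x → symGlue a b E M N 0 (-x) = symGlue a b E M N 0 x by
    rcases le_total 0 x with hx | hx
    · exact h x hx
    · have := h (-x) (by linarith)
      rw [neg_neg] at this
      exact this.symm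
  intro x hx
  rcases lt_or_ge x (-b) with h1 | h1
  · rw [symGlue_of_mem_middle hab (by linarith) (by linarith),
      symGlue_of_mem_middle hab (by linarith) h1, hNs]
  rcases lt_or_ge x (-a) with h2 | h2
  · rw [symGlue_of_mem_right hab hb h1 h2, pow_zero, one_mul]
    rcases h1.eq_or_lt with rfl | h1
    · rw [neg_neg, symGlue_of_mem_middle hab le_rfl (by linarith), hMN]
    · rw [symGlue_of_mem_left (by linarith) (by linarith)]
  · rw [symGlue_of_le hab hb h2, pow_zero, one_mul]
    rcases h2.eq_or_lt with rfl | h2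
    · rw [neg_neg, symGlue_of_mem_left le_rfl hab, hEM]
    · rw [symGlue_of_lt (by linarith)]

/-- The junctions are excluded because the half-open conventions disagree on the right: at `-b` the
glued family already follows the reflected `M`, whereas the potential still takes its inner value.
-/
theorem symGlue_four_add {k A B : ℝ} (hab : a < b) (hb : b < 0)
    (hE : ∀ x, E 4 x = k ^ 4 * E 0 x) (hM : ∀ x, M 4 x = -A * M 0 x)
    (hN : ∀ x, N 4 x = B * N 0 x) {x : ℝ} (hx : x ∉ ({a, b, -b, -a} : Set ℝ)) :
    symGlue a b E M N 4 x + stepPotential k a b A B x * symGlue a b E M N 0 x =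
      k ^ 4 * symGlue a b E M N 0 x := by
  simp only [mem_insert_iff, mem_singleton_iff, not_or] at hx
  obtain ⟨-, -, hx3, hx4⟩ := hx
  rcases symGlue_cases a b x with h | ⟨h1, h2⟩ | ⟨h1, h2⟩ | ⟨h1, h2⟩ | h
  · have hq : stepPotential k a b A B x = 0 := by
      rw [stepPotential, abs_of_neg (by linarith), neg_neg, if_pos h]
    rw [hq, symGlue_of_lt h, symGlue_of_lt h, hE]
    ring
  · have hq : stepPotential k a b A B x = A + k ^ 4 := by
      rw [stepPotential, stepQ₀, abs_of_neg (by linarith), neg_neg, if_neg h1.not_gt, if_pos h2]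
    rw [hq, symGlue_of_mem_left h1 h2, symGlue_of_mem_left h1 h2, hM]
    ring
  · have hq : stepPotential k a b A B x = -B + k ^ 4 := by
      have : |x| ≤ -b := abs_le.2 ⟨by linarith, by linarith⟩
      rw [stepPotential, stepQ₀, if_neg (by linarith), if_neg (by linarith)]
    rw [hq, symGlue_of_mem_middle hab h1 h2, symGlue_of_mem_middle hab h1 h2, hN]
    ring
  · have h1' : -b < x := lt_of_le_of_ne h1 (Ne.symm hx3)
    have hq : stepPotential k a b A B x = A + k ^ 4 := by
      rw [stepPotential, stepQ₀, abs_of_pos (by linarith), if_neg (by linarith),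
        if_pos (by linarith)]
    rw [hq, symGlue_of_mem_right hab hb h1 h2, symGlue_of_mem_right hab hb h1 h2, hM]
    ring
  · have h' : -a < x := lt_of_le_of_ne h (Ne.symm hx4)
    have hq : stepPotential k a b A B x = 0 := by
      rw [stepPotential, abs_of_pos (by linarith), if_pos (by linarith)]
    rw [hq, symGlue_of_le hab hb h, symGlue_of_le hab hb h, hE]
    ring

/-- On a bounded interval any continuous function is dominated by the decaying exponential, so only
the outer pieces decide membership in `L²`. -/
theorem exists_abs_le_mul_exp {f : ℝ → ℝ} (hf : Continuous f) (k R : ℝ) :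
    ∃ K, 0 ≤ K ∧ ∀ x, |x| ≤ R → |f x| ≤ K * Real.exp (-k * |x|) := by
  have hc : ContinuousOn (fun x => f x * Real.exp (k * |x|)) (Icc (-R) R) := by fun_prop
  obtain ⟨K, hK⟩ := isCompact_Icc.exists_bound_of_continuousOn hc
  refine ⟨|K|, abs_nonneg K, fun x hx => ?_⟩
  have h := (hK x (abs_le.1 hx)).trans (le_abs_self K)
  rw [norm_mul, Real.norm_eq_abs, Real.norm_of_nonneg (Real.exp_pos _).le] at h
  rw [neg_mul, Real.exp_neg, ← div_eq_mul_inv, le_div_iff₀ (Real.exp_pos _)]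
  exact h

theorem exists_abs_symGlue_le {k : ℝ} (hk : 0 < k) (hab : a < b) (hb : b < 0)
    (hM : ∀ j, Continuous (M j)) (hN : ∀ j, Continuous (N j)) (j : ℕ) :
    ∃ K, ∀ x, |symGlue a b (expJet k) M N j x| ≤ K * Real.exp (-k * |x|) := by
  obtain ⟨K₁, hK₁, h₁⟩ := exists_abs_le_mul_exp (hM j) k (-a)
  obtain ⟨K₂, hK₂, h₂⟩ := exists_abs_le_mul_exp (hN j) k (-a)
  have hexp : ∀ x ≤ 0, |expJet k j x| ≤ k ^ j * Real.exp (-k * |x|) := by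
    intro x hx
    rw [expJet, abs_of_nonneg (by positivity), abs_of_nonpos hx, neg_mul_neg]
  have hkj : 0 < k ^ j := by positivity
  refine ⟨k ^ j + K₁ + K₂, fun x => ?_⟩
  have he := Real.exp_pos (-k * |x|)
  rcases symGlue_cases a b x with h | ⟨h1, h2⟩ | ⟨h1, h2⟩ | ⟨h1, h2⟩ | h
  · rw [symGlue_of_lt h]
    refine (hexp x (by linarith)).trans ?_
    gcongr
    linarith
  · rw [symGlue_of_mem_left h1 h2]
    refine (h₁ x (abs_le.2 ⟨by linarith, by linarith⟩)).trans ?_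
    gcongr
    linarith
  · rw [symGlue_of_mem_middle hab h1 h2]
    refine (h₂ x (abs_le.2 ⟨by linarith, by linarith⟩)).trans ?_
    gcongr
    linarith
  · rw [symGlue_of_mem_right hab hb h1 h2, abs_mul, abs_pow, abs_neg, abs_one, one_pow, one_mul]
    refine (h₁ (-x) (abs_le.2 ⟨by linarith, by linarith⟩)).trans ?_
    rw [abs_neg]
    gcongr
    linarith
  · rw [symGlue_of_le hab hb h, abs_mul, abs_pow, abs_neg, abs_one, one_pow, one_mul]
    refine (hexp (-x) (by linarith)).trans ?_
    rw [abs_neg]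
    gcongr
    linarith

theorem measurable_symGlue (hE : ∀ j, Continuous (E j)) (hM : ∀ j, Continuous (M j))
    (hN : ∀ j, Continuous (N j)) (j : ℕ) : Measurable (symGlue a b E M N j) := by
  have hr : ∀ F : ℕ → ℝ → ℝ, Continuous (F j) → Measurable (reflectJet F j) := fun F hF =>
    (continuous_const.mul (hF.comp continuous_neg)).measurable
  exact Measurable.ite measurableSet_Iio (hE j).measurable
    (Measurable.ite measurableSet_Iio (hM j).measurable
      (Measurable.ite measurableSet_Iio (hN j).measurable
        (Measurable.ite measurableSet_Iio (hr M (hM j)) (hr E (hE j)))))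

end SymmetricGlue

/-! ### Integrability and support of the potential -/

section Potential

theorem even_stepPotential (k a b A B : ℝ) : Function.Even (stepPotential k a b A B) := by
  intro x
  simp only [stepPotential, abs_neg]

theorem stepPotential_eq_zero {k a b A B x : ℝ} (h : -a < |x|) : stepPotential k a b A B x = 0 :=
  if_pos (by linarith)

theorem hasCompactSupport_stepPotential (k a b A B : ℝ) :
    HasCompactSupport (stepPotential k a b A B) := by
  refine HasCompactSupport.intro (isCompact_Icc (a := a) (b := -a)) fun x hx => ?_
  refine stepPotential_eq_zero ?_
  by_contra! h
  have := abs_le.1 h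
  exact hx ⟨by linarith, this.2⟩

theorem measurable_stepPotential (k a b A B : ℝ) : Measurable (stepPotential k a b A B) := by
  have h : Measurable fun x : ℝ => -|x| := by fun_prop
  exact Measurable.ite (h measurableSet_Iio) measurable_const
    ((Measurable.ite (h measurableSet_Iio) measurable_const measurable_const).add_const _)

theorem norm_stepPotential_le (k a b A B x : ℝ) :
    ‖stepPotential k a b A B x‖ ≤ |A| + |B| + k ^ 4 := by
  have hk : 0 ≤ k ^ 4 := by positivity
  have hA := abs_nonneg A
  have hB := abs_nonneg B
  rw [stepPotential, stepQ₀, Real.norm_eq_abs]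
  split_ifs
  · rw [abs_zero]; positivity
  · refine (abs_add_le _ _).trans ?_
    rw [abs_of_nonneg hk]
    linarith
  · refine (abs_add_le _ _).trans ?_
    rw [abs_of_nonneg hk, abs_neg]
    linarith

theorem memLp_stepPotential (k a b A B : ℝ) (p : ENNReal) :
    MemLp (stepPotential k a b A B) p volume := by
  have h : MemLp (fun _ : ℝ => |A| + |B| + k ^ 4) p (volume.restrict (Icc a (-a))) :=
    memLp_const _
  have h2 : MemLp (stepPotential k a b A B) p (volume.restrict (Icc a (-a))) :=
    h.of_le (measurable_stepPotential k a b A B).aestronglyMeasurable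
      (Filter.Eventually.of_forall fun x =>
        (norm_stepPotential_le k a b A B x).trans (le_abs_self _))
  have h3 := (memLp_indicator_iff_restrict measurableSet_Icc).2 h2
  rwa [indicator_eq_self.2] at h3
  intro x hx
  by_contra hn
  refine hx (stepPotential_eq_zero ?_)
  by_contra! h
  have := abs_le.1 h
  exact hn ⟨by linarith, this.2⟩

end Potential

/-! ### Assembling the eigenfunction -/

section Eigenfunction

open Real

theorem exists_eigenJet {k : ℝ} (hk : 0 < k) :
    ∃ (a b A B : ℝ) (F : ℕ → ℝ → ℝ), a < b ∧ b < 0 ∧ 0 < A ∧ 0 < B ∧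
      IsJet {a, b, -b, -a} F ∧ (∀ x < a, F 0 x = exp (k * x)) ∧ F 1 0 = 0 ∧ F 3 0 = 0 ∧
      (∀ x, F 0 (-x) = F 0 x) ∧
      (∀ x ∉ ({a, b, -b, -a} : Set ℝ),
        F 4 x + stepPotential k a b A B x * F 0 x = k ^ 4 * F 0 x) ∧
      (∀ j, ∃ K, ∀ x, |F j x| ≤ K * exp (-k * |x|)) ∧ ∀ j, Measurable (F j) := by
  obtain ⟨r, y, hr, hy, h1, h2⟩ := exists_matching_parameters
  -- The scale `α` is fixed by `αr = k`; then `b` and `a` are fixed by `βb = -π` with `β = yα`, and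
  -- by `α(b - a) = π`.
  set α := k / r with hα
  have hα0 : 0 < α := div_pos hk hr
  have hαr : α * r = k := div_mul_cancel₀ _ hr.ne'
  set b := -π / (y * α) with hb
  set a := b - π / α with ha
  have hb0 : b < 0 := div_neg_of_neg_of_pos (by linarith [pi_pos]) (by positivity)
  have hab : a < b := sub_lt_self _ (div_pos pi_pos hα0)
  have hba : α * (b - a) = π := by
    rw [ha, sub_sub_cancel]
    exact mul_div_cancel₀ _ hα0.ne'
  have hβb : y * α * b = -π := mul_div_cancel₀ _ (by positivity)
  obtain ⟨c₁, c₂, hc⟩ := midJet_eq_innerJet (c := exp (k * a)) hy.ne' hba hβb h1 h2 hr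
  set c := exp (k * a) with hcdef
  have hEM : ∀ j ≤ 3, expJet k j a = midJet α a c (c * r) (c * r ^ 2) (c * r ^ 3) j a := by
    intro j hj
    rw [midJet_left α a r c j hj, hαr]
    rfl
  have hEj : ∀ j, Continuous (expJet k j) := fun j =>
    continuous_iff_continuousAt.2 fun x => (hasDerivAt_expJet k j x).continuousAt
  refine ⟨a, b, 4 * α ^ 4, (y * α) ^ 4,
    symGlue a b (expJet k) (midJet α a c (c * r) (c * r ^ 2) (c * r ^ 3)) (innerJet (y * α) c₁ c₂),
    hab, hb0, by positivity, by positivity, ?_, fun x hx => ?_, ?_, ?_, ?_, fun x hx => ?_,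
    fun j => ?_, fun j => ?_⟩
  · exact isJet_symGlue hab hb0 (IsJet.of_hasDerivAt fun j _ x => hasDerivAt_expJet k j x)
      (isJet_midJet _ _ _ _ _ _) (isJet_innerJet _ _ _) hEM hc (innerJet_neg _ _ _)
  · rw [symGlue_of_lt hx, expJet, pow_zero, one_mul]
  · rw [symGlue_of_mem_middle hab hb0.le (by linarith)]
    simp [innerJet]
  · rw [symGlue_of_mem_middle hab hb0.le (by linarith)]
    simp [innerJet]
  · exact symGlue_zero_neg hab hb0 (hEM 0 (by norm_num)) (hc 0 (by norm_num)) fun x => by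
      simpa using innerJet_neg (y * α) c₁ c₂ 0 (by norm_num) x
  · refine symGlue_four_add hab hb0 (fun x => ?_) (fun x => ?_) (fun x => rfl) hx
    · simp [expJet]
    · simp only [midJet]
      ring
  · exact exists_abs_symGlue_le hk hab hb0 (continuous_midJet _ _ _ _ _ _)
      (continuous_innerJet _ _ _) j
  · exact measurable_symGlue hEj (continuous_midJet _ _ _ _ _ _) (continuous_innerJet _ _ _) j

theorem isEigenvectorOf_fourthOrderOperator {q : ℝ → ℝ} {z : ℂ} {u : L2R} (hu : u ≠ 0)
    (h : (u, z • u) ∈ fourthOrderGraph q) : IsEigenvectorOf (fourthOrderOperator q) z u := by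
  rw [← fourthOrderOperator_graph, LinearPMap.mem_graph_iff] at h
  obtain ⟨v, hv1, hv2⟩ := h
  simp only at hv1 hv2
  subst hv1
  exact ⟨hu, v.2, hv2⟩

end Eigenfunction

/-! ### The embedded eigenvalue -/

theorem mainTheorem2 (k₀ : ℝ) (hk₀ : 0 < k₀) :
    ∃ a b A B : ℝ, a < b ∧ b < 0 ∧ 0 < A ∧ 0 < B ∧
      Function.Even (stepPotential k₀ a b A B) ∧
      HasCompactSupport (stepPotential k₀ a b A B) ∧
      (∃ g : ℝ → ℝ,
        -- `g` solves `g'''' + q g = k₀⁴ g` on the real line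
        ContDiff ℝ 3 g ∧
        (∀ x : ℝ, x ∉ ({a, b, -b, -a} : Set ℝ) →
          DifferentiableAt ℝ (iteratedDeriv 3 g) x ∧
          iteratedDeriv 4 g x + stepPotential k₀ a b A B x * g x = k₀ ^ 4 * g x) ∧
        (∀ x : ℝ, x < a → g x = Real.exp (k₀ * x)) ∧
        deriv g 0 = 0 ∧ iteratedDeriv 3 g 0 = 0 ∧ Function.Even g ∧
        -- `g` is an `L²` eigenfunction of `L` with eigenvalue `k₀⁴`
        ∃ hg : MemLp (fun x : ℝ => (g x : ℂ)) 2 volume,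
          IsEigenvectorOf (fourthOrderOperator (stepPotential k₀ a b A B))
            ((k₀ ^ 4 : ℝ) : ℂ) (hg.toLp (fun x : ℝ => (g x : ℂ)))) ∧
      -- the eigenvalue is embedded in the continuous spectrum `[0, ∞)`
      continuousSpectrum (fourthOrderOperator (stepPotential k₀ a b A B)) =
        (fun t : ℝ => (t : ℂ)) '' Ici 0 ∧
      ((k₀ ^ 4 : ℝ) : ℂ) ∈
        continuousSpectrum (fourthOrderOperator (stepPotential k₀ a b A B)) := by
  obtain ⟨a, b, A, B, F, hab, hb, hA, hB, hF, hFe, hF1, hF3, hFs, hF4, hFb, hFm⟩ :=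
    exists_eigenJet hk₀
  have hspec : continuousSpectrum (fourthOrderOperator (stepPotential k₀ a b A B)) =
      (fun t : ℝ => (t : ℂ)) '' Ici 0 :=
    continuousSpectrum_fourthOrderOperator (memLp_stepPotential k₀ a b A B ⊤).ofReal
      -- The potential is nonzero possibly at `x = -a` itself, so `R` is taken strictly beyond it.
      (memLp_stepPotential k₀ a b A B 2) (R := -a + 1) fun x hx =>
        stepPotential_eq_zero (by linarith [le_abs_self x])
  refine ⟨a, b, A, B, hab, hb, hA, hB, even_stepPotential _ _ _ _ _,
    hasCompactSupport_stepPotential _ _ _ _ _, ⟨F 0, hF.contDiff, fun x hx => ⟨?_, ?_⟩, hFe, ?_, ?_,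
      hFs, ?_⟩, hspec, ?_⟩
  · rw [hF.iteratedDeriv_eq 3 le_rfl]
    exact (hF.hasDerivAt_three x hx).differentiableAt
  · rw [hF.iteratedDeriv_four hx]
    exact hF4 x hx
  · rw [(hF.hasDerivAt 0 (by norm_num) 0).deriv]
    exact hF1
  · rw [hF.iteratedDeriv_eq 3 le_rfl]
    exact hF3
  · choose K hK using hFb
    have hL : ∀ j, MemLp (fun x => (F j x : ℂ)) 2 volume := fun j =>
      memLp_two_of_le_exp (hFm j).aestronglyMeasurable hk₀ (hK j)
    have hK0 : ∀ j, 0 ≤ K j := fun j => by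
      simpa using (abs_nonneg _).trans (hK j 0)
    have hbound : ∀ j ≤ 4, ∀ x, |F j x| ≤ ∑ i ∈ Finset.range 5, K i := by
      intro j hj x
      calc |F j x| ≤ K j * Real.exp (-k₀ * |x|) := hK j x
        _ ≤ K j * 1 := by
          refine mul_le_mul_of_nonneg_left (Real.exp_le_one_iff.2 ?_) (hK0 j)
          have := mul_nonneg hk₀.le (abs_nonneg x)
          linarith
        _ ≤ ∑ i ∈ Finset.range 5, K i := by
          rw [mul_one]
          exact Finset.single_le_sum (fun i _ => hK0 i) (Finset.mem_range.2 (by omega))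
    refine ⟨hL 0, isEigenvectorOf_fourthOrderOperator (fun h0 => ?_) ?_⟩
    · have h1 := (hL 0).coeFn_toLp
      rw [h0] at h1
      have h2 : (fun x => (F 0 x : ℂ)) =ᵐ[volume] fun _ => 0 :=
        h1.symm.trans (Lp.coeFn_zero ℂ 2 volume)
      -- A continuous function that vanishes almost everywhere vanishes identically, but left of `a`
      -- it is an exponential.
      have h3 := (Continuous.ae_eq_iff_eq volume
        (Complex.continuous_ofReal.comp (hF.continuous (by norm_num))) continuous_const).1 h2
      have h4 := congrFun h3 (a - 1)
      have h5 : F 0 (a - 1) = 0 := Complex.ofReal_eq_zero.1 h4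
      rw [hFe _ (by linarith)] at h5
      exact (Real.exp_pos _).ne' h5
    · refine ⟨(hL 4).toLp _,
        hF.fourthDistDeriv_toLp (Set.toFinite _).countable (fun j _ => hL j) hbound, ?_⟩
      have hae : ∀ᵐ x : ℝ, x ∉ ({a, b, -b, -a} : Set ℝ) :=
        measure_eq_zero_iff_ae_notMem.1 ((Set.toFinite _).measure_zero volume)
      filter_upwards [hae, (hL 0).coeFn_toLp, (hL 4).coeFn_toLp,
        Lp.coeFn_smul ((k₀ ^ 4 : ℝ) : ℂ) ((hL 0).toLp _)] with x hx h1 h2 h3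
      rw [h3, Pi.smul_apply, h1, h2, smul_eq_mul]
      exact_mod_cast (hF4 x hx).symm
  · rw [hspec]
    exact ⟨k₀ ^ 4, by simp only [mem_Ici]; positivity, rfl⟩
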